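/- **Proposition 2.7.** Let $d\ge 1$. For $\vec x_1,\dots,\vec x_N\in\mathbb{R}^d$ let $C=\operatorname{chull}(\vec x_1,\dots,\vec x_N)$ be their convex hull, $\operatorname{ext}(C)$ the set of extreme points of $C$, and $H^+_{\vec u,t}=\{\vec z\in\mathbb{R}^d:\sum_i z_iu_i\ge t\}$. Let $\operatorname{extchull}_N$ be the map $(\vec x_1,\dots,\vec x_N)\mapsto\operatorname{ext}(C)$, defined on the $N$-tuples of pairwise distinct points of $\mathbb{R}^d$, with values in the closed subsets of $\mathbb{R}^d$. *Conventions.* Computability and continuity are those of Type-2 machines and realizers on infinite names. A $\rho^{d\times N}$-name of $(\vec x_1,\dots,\vec x_N)$ gives, for each coordinate of each point, rationals $q_0,q_1,\dots$ with error of $q_n$ at most $2^{-n}$; $\nu$ is the standard notation of discrete objects. A $\psi_<^d$-name of a closed set $A\subseteq\mathbb{R}^d$ enumerates all rational open balls that meet $A$ (for $A\neq\emptyset$: approximations of the distance function $d_A$ from above); a $\psi_>^d$-name enumerates all rational closed balls disjoint from $A$ (for $A\ne\emptyset$: approximations of $d_A$ from below). A partial map $f:\subseteq X\to Y$ between represented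 spaces $(X,\alpha)$, $(Y,\beta)$ is *$(\alpha,\beta)$-computable with $k$-wise advice* if there are a partition $\Delta$ of $\operatorname{dom}(f)$ into $k$ nonempty parts and a notation $\delta$ of $\Delta$ such that $(a,D)\mapsto f(a)$, defined for $a\in D\in\Delta$, is $(\alpha,\delta,\beta)$-computable. It is *$k$-wise $(\alpha,\beta)$-continuous* if there is a partition $\Delta$ of $\operatorname{dom}(f)$ into $k$ nonempty parts such that $f|_D$ has a continuous $(\alpha,\beta)$-realizer for each $D\in\Delta$; otherwise it is $k$-wise $(\alpha,\beta)$-discontinuous. Let $\vec x_1,\dots,\vec x_N\in\mathbb{R}^d$ be pairwise distinct. (a) If $\vec y\in\operatorname{ext}(C)$, then there are a rational vector $\vec u\in\mathbb{Q}^d\setminus\{0\}$ and $t\in\mathbb{R}$ such that $H^+_{\vec u,t}\cap\{\vec x_1,\dots,\vec x_N\}=\{\vec y\}=\{\vec x_j\}$ for some $1\le j\le N$. (b) Conversely, if $\vec u\in\mathbb{R}^d\setminus\{0\}$, $t\in\mathbb{R}$ and $H^+_{\vec u,t}\cap\{\vec x_1,\dots,\vec x_N\}=\{\vec x_j\}$,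 then $\vec x_j\in\operatorname{ext}(C)$. (c) Given a $\rho^{d\times N}$-name of $(\vec x_1,\dots,\vec x_N)$ as above and $j\in\{1,\dots,N\}$, the property "$\vec x_j\in\operatorname{ext}(C)$" is semi-decidable. (d) The map $\operatorname{extchull}_N$ is $(\rho^{d\times N},\psi_<^d)$-computable. (e) Let $N\ge 2$. Then $M:=\operatorname{Card}\operatorname{ext}(C)\in\{2,\dots,N\}$, and $\operatorname{ext}(C)=\{\vec x_{i_1},\dots,\vec x_{i_M}\}$ for a unique index set $\{i_1,\dots,i_M\}\subseteq\{1,\dots,N\}$ of size $M$. Given $M$ in addition to $(\vec x_1,\dots,\vec x_N)$, this index set is $(\rho^{d\times N},\nu)$-computable, and $\operatorname{ext}(C)$ is $(\rho^{d\times N},\psi_>^d)$-computable. In particular, $\operatorname{extchull}_N$ is $(\rho^{d\times N},\psi_>^d)$-computable with $(N-1)$-wise advice. (f) If $d\ge2$ and $N\ge2$, then $\operatorname{extchull}_N$ is $(N-2)$-wise $(\rho^{d\times N},\psi_>^d)$-discontinuous; indeed it is $k$-wise $(\rho^{d\times N},\psi_>^d)$-discontinuous for every $k\le N-2$. -/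

import Mathlib

/-!
Type-2 computability (TTE) on Baire space, the representations `ρ`, `ψ_<`, `ψ_>` of real vectors and
closed sets, computability with `k`-wise advice, and the map `extchull_N`.
-/

namespace TTE

/-- Names are elements of Baire space (symbols are natural numbers). -/
abbrev Name : Type := ℕ → ℕ

/-- The finite prefix of length `n` of a name. -/
def pre (p : Name) (n : ℕ) : List ℕ := (List.range n).map p

/-- A representation of `X`: a surjective partial map from names onto `X`, given by its graph
(`Names p x` means "`p` is a name of `x`"). -/
structure Representation (X : Type*) where
  Names : Name → X → Prop
  unique : ∀ p x y, Names p x → Names p y → x = y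
  surj : ∀ x, ∃ p, Names p x

/-! ### Machines

A Type-2 machine with one-way output tape is given by the computable function `h` that sends
a finite prefix of the input to the part of the output written on the basis of that prefix;
longer inputs can only extend the output. -/

/-- `h` is the word function of a Type-2 machine: Turing computable and monotone for prefixes. -/
def IsMachine (h : List ℕ → List ℕ) : Prop :=
  Computable h ∧ ∀ u v : List ℕ, u <+: v → h u <+: h v

/-- On the infinite input `p`, the machine `h` writes the infinite output `q`. -/
def Outputs (h : List ℕ → List ℕ) (p q : Name) : Prop :=
  ∀ n, ∃ k, pre q n <+: h (pre p k)

/-- The partial function `f` with domain `A` is `(α, β)`-computable: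
some machine transforms every `α`-name of every `x ∈ A` into a `β`-name of `f x`. -/
def ComputableOn {X Y : Type*} (α : Representation X) (β : Representation Y)
    (f : X → Y) (A : Set X) : Prop :=
  ∃ h : List ℕ → List ℕ, IsMachine h ∧
    ∀ p x, x ∈ A → α.Names p x → ∃ q, Outputs h p q ∧ β.Names q (f x)

/-- The partial function `f` with domain `A` is `(α, β)`-continuous: it has a realizer that is
continuous (for the product topology on Baire space) on the set of names of elements of `A`. -/
def ContinuousRealizable {X Y : Type*} (α : Representation X) (β : Representation Y)
    (f : X → Y) (A : Set X) : Prop :=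
  ∃ F : Name → Name, ContinuousOn F {p | ∃ x ∈ A, α.Names p x} ∧
    ∀ p x, x ∈ A → α.Names p x → β.Names (F p) (f x)

/-- `U` is semi-decidable within `A`: some machine, reading an `α`-name of `x ∈ A`, halts (after
having read finitely many symbols) if and only if `x ∈ U`. -/
def SemiDecidableOn {X : Type*} (α : Representation X) (U A : Set X) : Prop :=
  ∃ h : List ℕ → Bool, Computable h ∧
    ∀ p x, x ∈ A → α.Names p x → (x ∈ U ↔ ∃ n, h (pre p n) = true)

/-! ### Constructions of representations -/

/-- A notation (a surjective partial map from finite codes), viewed as a representation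
that looks only at the first symbol. -/
def ofNotation {X : Type*} (δ : ℕ →. X) (hδ : ∀ x, ∃ c, x ∈ δ c) : Representation X where
  Names p x := x ∈ δ (p 0)
  unique _ _ _ hx hy := Part.mem_unique hx hy
  surj x := let ⟨c, hc⟩ := hδ x; ⟨fun _ => c, hc⟩

/-- The standard notation of `ℕ`, of `Fin N`, and of other (finite) discrete sets. -/
def nu (X : Type*) [Encodable X] : Representation X :=
  ofNotation (fun c => (Encodable.decode c : Option X))
    (fun x => ⟨Encodable.encode x, by simp⟩)

/-- Pairs are named by interleaving names of the components. -/
def Representation.prod {X Y : Type*} (α : Representation X) (β : Representation Y) :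
    Representation (X × Y) where
  Names p z := α.Names (fun n => p (2 * n)) z.1 ∧ β.Names (fun n => p (2 * n + 1)) z.2
  unique _ _ _ hx hy := Prod.ext (α.unique _ _ _ hx.1 hy.1) (β.unique _ _ _ hx.2 hy.2)
  surj z := by
    obtain ⟨a, ha⟩ := α.surj z.1
    obtain ⟨b, hb⟩ := β.surj z.2
    refine ⟨fun n => if n % 2 = 0 then a (n / 2) else b (n / 2), ?_, ?_⟩
    · convert ha using 2 with n
      simp
    · convert hb using 2 with n
      have h1 : (2 * n + 1) % 2 = 1 := by omega
      have h2 : (2 * n + 1) / 2 = n := by omega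
      simp [h1, h2]

/-- The `N`-fold power of a representation: the name of a tuple contains the name of its
`j`-th component at the positions `⟨j, n⟩`. -/
def Representation.pow {X : Type*} (α : Representation X) (N : ℕ) :
    Representation (Fin N → X) where
  Names p x := ∀ j : Fin N, α.Names (fun n => p (Nat.pair j n)) (x j)
  unique _ _ _ hx hy := funext fun j => α.unique _ _ _ (hx j) (hy j)
  surj x := by
    choose a ha using fun j => α.surj (x j)
    refine ⟨fun m => if h : (Nat.unpair m).1 < N then a ⟨_, h⟩ (Nat.unpair m).2 else 0,
      fun j => ?_⟩
    convert ha j using 2 with n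
    simp

/-! ### Real numbers and vectors -/

/-- The standard numbering of the rationals: `⟨a, ⟨b, c⟩⟩ ↦ (a - b) / (c + 1)`. -/
def ratOf (n : ℕ) : ℚ :=
  (((Nat.unpair n).1 : ℚ) - ((Nat.unpair (Nat.unpair n).2).1 : ℚ)) /
    (((Nat.unpair (Nat.unpair n).2).2 : ℚ) + 1)

theorem ratOf_surjective : Function.Surjective ratOf := by
  intro q
  refine ⟨Nat.pair q.num.toNat (Nat.pair (-q.num).toNat (q.den - 1)), ?_⟩
  have hd : ((q.den - 1 : ℕ) : ℚ) + 1 = q.den := by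
    have := q.den_pos
    rw [Nat.cast_sub (by omega)]
    simp
  have hn : ((q.num.toNat : ℕ) : ℚ) - (((-q.num).toNat : ℕ) : ℚ) = q.num := by
    exact_mod_cast Int.toNat_sub_toNat_neg q.num
  simp only [ratOf, Nat.unpair_pair, hd, hn]
  exact Rat.num_div_den q

/-- The representation `ρ` of the reals: `p` names `x` iff it encodes a sequence of rationals
`q₀, q₁, …` with `|x - qₙ| ≤ 2⁻ⁿ`. -/
noncomputable def rho : Representation ℝ where
  Names p x := ∀ n, |x - (ratOf (p n) : ℝ)| ≤ (1 / 2 : ℝ) ^ n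
  unique p x y hx hy := by
    have h : ∀ n : ℕ, |x - y| ≤ 2 * (1 / 2 : ℝ) ^ n := fun n => by
      have h1 := abs_le.1 (hx n)
      have h2 := abs_le.1 (hy n)
      exact abs_le.2 ⟨by linarith [h1.1, h2.2], by linarith [h1.2, h2.1]⟩
    have ht : Filter.Tendsto (fun n : ℕ => 2 * (1 / 2 : ℝ) ^ n) Filter.atTop (nhds (2 * 0)) :=
      (tendsto_pow_atTop_nhds_zero_of_lt_one (by norm_num) (by norm_num)).const_mul 2
    have h0 : |x - y| ≤ 2 * 0 := ge_of_tendsto' ht h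
    have h1 : |x - y| = 0 := le_antisymm (by simpa using h0) (abs_nonneg _)
    exact sub_eq_zero.1 (abs_eq_zero.1 h1)
  surj x := by
    have h : ∀ n : ℕ, ∃ c : ℕ, |x - (ratOf c : ℝ)| ≤ (1 / 2 : ℝ) ^ n := fun n => by
      obtain ⟨q, h1, h2⟩ := exists_rat_btwn
        (show x < x + (1 / 2 : ℝ) ^ n by linarith [show (0 : ℝ) < (1 / 2) ^ n by positivity])
      obtain ⟨c, rfl⟩ := ratOf_surjective q
      exact ⟨c, abs_le.2 ⟨by linarith, by
        linarith [show (0 : ℝ) < (1 / 2) ^ n by positivity]⟩⟩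
    choose p hp using h
    exact ⟨p, hp⟩

/-- Euclidean space `ℝ^d`. -/
abbrev Vec (d : ℕ) : Type := EuclideanSpace ℝ (Fin d)

/-- The representation `ρ^d` of `ℝ^d`. -/
noncomputable def rhoVec (d : ℕ) : Representation (Vec d) where
  Names p x := (rho.pow d).Names p (fun i => x i)
  unique p x y hx hy := by
    have h := (rho.pow d).unique p _ _ hx hy
    ext i
    exact congrFun h i
  surj x := (rho.pow d).surj fun i => x i

/-- The representation `ρ^{d×N}` of the `N`-tuples of points of `ℝ^d`. -/
noncomputable def rhoTuple (d N : ℕ) : Representation (Fin N → Vec d) :=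
  (rhoVec d).pow N

/-! ### Closed sets -/

/-- Radius of the rational ball with code `k`. -/
def radius (k : ℕ) : ℚ := ratOf (Nat.unpair k).2

/-- Center of the rational ball in `ℝ^d` with code `k`. -/
noncomputable def center (d k : ℕ) : Vec d :=
  WithLp.toLp 2 fun i : Fin d =>
    (ratOf ((Denumerable.ofNat (List ℕ) (Nat.unpair k).1).getD i 0) : ℝ)

/-- The set of natural numbers enumerated by a name; the symbol `0` carries no information,
the symbol `k + 1` lists `k`. -/
def enumerated (p : Name) : Set ℕ := {k | ∃ n, p n = k + 1}

theorem exists_enumeration (S : Set ℕ) : ∃ p : Name, enumerated p = S := by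
  classical
  refine ⟨fun n => if n ∈ S then n + 1 else 0, ?_⟩
  ext k
  constructor
  · rintro ⟨n, hn⟩
    by_cases h : n ∈ S
    · simp only [h, if_true] at hn
      have : n = k := by omega
      exact this ▸ h
    · simp [h] at hn
  · intro h
    exact ⟨k, by simp [h]⟩

theorem exists_small_ball {d : ℕ} (x : Vec d) {ε : ℝ} (hε : 0 < ε) :
    ∃ k, x ∈ Metric.ball (center d k) (radius k) ∧
      Metric.closedBall (center d k) (radius k) ⊆ Metric.ball x ε := by
  have hdense : DenseRange fun q : Fin d → ℚ =>
      (WithLp.toLp 2 (fun i => (q i : ℝ)) : Vec d) := by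
    have h1 : DenseRange fun (q : Fin d → ℚ) (i : Fin d) => (q i : ℝ) :=
      DenseRange.piMap (f := fun (_ : Fin d) (q : ℚ) => (q : ℝ)) fun _ => Rat.denseRange_cast
    have h2 : DenseRange (WithLp.toLp 2 : (Fin d → ℝ) → Vec d) :=
      (WithLp.toLp_surjective 2).denseRange
    exact h2.comp h1 (PiLp.continuous_toLp 2 _)
  obtain ⟨q, hq⟩ := hdense.exists_dist_lt x (show 0 < ε / 4 by linarith)
  obtain ⟨r, hr1, hr2⟩ := exists_rat_btwn (show ε / 4 < ε / 2 by linarith)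
  obtain ⟨b, rfl⟩ := ratOf_surjective r
  choose c hc using fun i => ratOf_surjective (q i)
  have hcen : center d (Nat.pair (Encodable.encode (List.ofFn c)) b) =
      WithLp.toLp 2 (fun i => (q i : ℝ)) := by
    ext i
    simp [center, hc]
  have hrad : radius (Nat.pair (Encodable.encode (List.ofFn c)) b) = ratOf b := by
    simp [radius]
  refine ⟨Nat.pair (Encodable.encode (List.ofFn c)) b, ?_, ?_⟩
  · rw [hcen, hrad, Metric.mem_ball]
    linarith
  · rw [hcen, hrad]
    intro y hy
    rw [Metric.mem_closedBall] at hy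
    rw [Metric.mem_ball]
    have := dist_triangle_right y x (WithLp.toLp 2 (fun i => (q i : ℝ)) : Vec d)
    linarith

/-- The representation `ψ_<` of the closed subsets of `ℝ^d` (positive information):
a name of `A` enumerates all open rational balls that meet `A`. -/
noncomputable def psiLower (d : ℕ) : Representation (TopologicalSpace.Closeds (Vec d)) where
  Names p A := enumerated p =
    {k | (Metric.ball (center d k) (radius k) ∩ (A : Set (Vec d))).Nonempty}
  unique p A B hA hB := by
    have key : ∀ A B : TopologicalSpace.Closeds (Vec d),
        {k | (Metric.ball (center d k) (radius k) ∩ (A : Set (Vec d))).Nonempty} =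
        {k | (Metric.ball (center d k) (radius k) ∩ (B : Set (Vec d))).Nonempty} →
        (A : Set (Vec d)) ⊆ B := by
      intro A B h x hx
      rw [← B.isClosed.closure_eq]
      refine Metric.mem_closure_iff.2 fun ε hε => ?_
      obtain ⟨k, hk1, hk2⟩ := exists_small_ball x hε
      have hk : k ∈ {k | (Metric.ball (center d k) (radius k) ∩ (A : Set (Vec d))).Nonempty} :=
        ⟨x, hk1, hx⟩
      rw [h] at hk
      obtain ⟨y, hy1, hy2⟩ := hk
      exact ⟨y, hy2, Metric.mem_ball'.1 (hk2 (Metric.ball_subset_closedBall hy1))⟩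
    have h := hA.symm.trans hB
    exact SetLike.coe_injective ((key A B h).antisymm (key B A h.symm))
  surj _ := exists_enumeration _

/-- The representation `ψ_>` of the closed subsets of `ℝ^d` (negative information):
a name of `A` enumerates all closed rational balls that are disjoint from `A`. -/
noncomputable def psiUpper (d : ℕ) : Representation (TopologicalSpace.Closeds (Vec d)) where
  Names p A := enumerated p =
    {k | Disjoint (Metric.closedBall (center d k) (radius k)) (A : Set (Vec d))}
  unique p A B hA hB := by
    have key : ∀ A B : TopologicalSpace.Closeds (Vec d),
        {k | Disjoint (Metric.closedBall (center d k) (radius k)) (A : Set (Vec d))} =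
        {k | Disjoint (Metric.closedBall (center d k) (radius k)) (B : Set (Vec d))} →
        (B : Set (Vec d)) ⊆ A := by
      intro A B h x hx
      by_contra hxA
      obtain ⟨ε, hε, hball⟩ := Metric.isOpen_iff.1 A.isClosed.isOpen_compl x hxA
      obtain ⟨k, hk1, hk2⟩ := exists_small_ball x hε
      have hk : k ∈
          {k | Disjoint (Metric.closedBall (center d k) (radius k)) (A : Set (Vec d))} :=
        Set.disjoint_left.2 fun y hy => hball (hk2 hy)
      rw [h] at hk
      exact Set.disjoint_left.1 hk (Metric.ball_subset_closedBall hk1) hx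
    have h := hA.symm.trans hB
    exact SetLike.coe_injective ((key B A h.symm).antisymm (key A B h))
  surj _ := exists_enumeration _

/-- A `ψ_<`-name of a nonempty closed set lists the rational upper bounds of the distance
function `d_A` at rational points, i.e. it approximates `d_A` from above. -/
theorem psiLower_iff_dist {d : ℕ} (p : Name) (A : TopologicalSpace.Closeds (Vec d))
    (hA : (A : Set (Vec d)).Nonempty) :
    (psiLower d).Names p A ↔
      enumerated p = {k | Metric.infDist (center d k) (A : Set (Vec d)) < radius k} := by
  have h : {k | (Metric.ball (center d k) (radius k) ∩ (A : Set (Vec d))).Nonempty} =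
      {k | Metric.infDist (center d k) (A : Set (Vec d)) < radius k} := by
    ext k
    rw [Set.mem_ofPred_eq, Set.mem_ofPred_eq, Metric.infDist_lt_iff hA]
    constructor
    · rintro ⟨y, hy, hyA⟩
      exact ⟨y, hyA, Metric.mem_ball'.1 hy⟩
    · rintro ⟨y, hyA, hy⟩
      exact ⟨y, Metric.mem_ball'.2 hy, hyA⟩
  rw [← h]
  rfl

/-- A `ψ_>`-name of a nonempty closed set lists the strict rational lower bounds of the distance
function `d_A` at rational points, i.e. it approximates `d_A` from below. -/
theorem psiUpper_iff_dist {d : ℕ} (p : Name) (A : TopologicalSpace.Closeds (Vec d))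
    (hA : (A : Set (Vec d)).Nonempty) :
    (psiUpper d).Names p A ↔
      enumerated p = {k | (radius k : ℝ) < Metric.infDist (center d k) (A : Set (Vec d))} := by
  have h : {k | Disjoint (Metric.closedBall (center d k) (radius k)) (A : Set (Vec d))} =
      {k | (radius k : ℝ) < Metric.infDist (center d k) (A : Set (Vec d))} := by
    ext k
    rw [Set.mem_ofPred_eq, Set.mem_ofPred_eq]
    constructor
    · intro hk
      obtain ⟨y, hyA, hy⟩ := A.isClosed.exists_infDist_eq_dist hA (center d k)
      rw [hy]
      by_contra hlt
      exact Set.disjoint_left.1 hk (Metric.mem_closedBall'.2 (not_lt.1 hlt)) hyA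
    · intro hk
      refine Set.disjoint_left.2 fun y hy hyA => ?_
      have := Metric.infDist_le_dist_of_mem (x := center d k) hyA
      rw [Metric.mem_closedBall'] at hy
      linarith
  rw [← h]
  rfl

/-! ### Advice -/

/-- `Δ` is a partition of the set `A` (into nonempty parts). -/
def IsPartitionOf {X : Type*} (Δ : Set (Set X)) (A : Set X) : Prop :=
  ∅ ∉ Δ ∧ Δ.PairwiseDisjoint id ∧ ⋃₀ Δ = A

/-- The partial function `f` with domain `A` is `(α, β)`-computable with `k`-wise advice: for some
partition `Δ` of `A` into `k` parts and some notation `δ` of `Δ`, the map `(a, D) ↦ f a` with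
domain `{(a, D) : a ∈ D ∈ Δ}` is `(α, δ, β)`-computable. -/
def ComputableWithAdvice {X Y : Type*} (α : Representation X) (β : Representation Y)
    (f : X → Y) (A : Set X) (k : ℕ) : Prop :=
  ∃ Δ : Set (Set X), IsPartitionOf Δ A ∧ Δ.encard = k ∧
    ∃ (δ : ℕ →. Δ) (hδ : ∀ D, ∃ c, D ∈ δ c),
      ComputableOn (α.prod (ofNotation δ hδ)) β (fun z => f z.1) {z | z.1 ∈ z.2.1}

/-- The partial function `f` with domain `A` is `k`-wise `(α, β)`-continuous: for some
partition `Δ` of `A` into `k` parts, `f` is `(α, β)`-continuous on each part. -/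
def KWiseContinuous {X Y : Type*} (α : Representation X) (β : Representation Y)
    (f : X → Y) (A : Set X) (k : ℕ) : Prop :=
  ∃ Δ : Set (Set X), IsPartitionOf Δ A ∧ Δ.encard = k ∧
    ∀ D ∈ Δ, ContinuousRealizable α β f D

/-! ### Extreme points of the convex hull -/

/-- The set of extreme points of the convex hull of `x₁, …, x_N`. -/
def extPts {d N : ℕ} (x : Fin N → Vec d) : Set (Vec d) :=
  (convexHull ℝ (Set.range x)).extremePoints ℝ

theorem extPts_subset {d N : ℕ} (x : Fin N → Vec d) : extPts x ⊆ Set.range x :=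
  extremePoints_convexHull_subset

/-- The map `extchull_N`, with values in the closed subsets of `ℝ^d`. -/
def extchull (d N : ℕ) (x : Fin N → Vec d) : TopologicalSpace.Closeds (Vec d) :=
  ⟨extPts x, ((Set.finite_range x).subset (extPts_subset x)).isClosed⟩

/-- The indices of the extreme points. -/
noncomputable def extIndices {d N : ℕ} (x : Fin N → Vec d) : Finset (Fin N) :=
  (Set.toFinite {j | x j ∈ extPts x}).toFinset

/-- The `N`-tuples of pairwise distinct points of `ℝ^d`, the domain of `extchull_N`. -/
def distinctTuples (d N : ℕ) : Set (Fin N → Vec d) := {x | Function.Injective x}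

/-- The closed halfspace `{z : ∑ zᵢ uᵢ ≥ t}`. -/
def halfspace {d : ℕ} (u : Fin d → ℝ) (t : ℝ) : Set (Vec d) := {z | t ≤ ∑ i, z i * u i}

end TTE

namespace TTE

open Filter Topology

/-! ### Extreme points of the convex hull of finitely many points -/

/-! A point of the tuple is extreme iff some linear functional attains its maximum over the tuple at
that point only. Such a functional comes from Hahn–Banach, and finitely many strict inequalities
define an open set of functionals, so a rational one exists (`exists_rat_functional`). Extremality
is therefore recognized by a search over rational vectors, with strict inequalities between
approximable reals as the test (`semiDec_mem_extPts`). This yields all the positive information.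

Negative information needs a proof that the search is over. If the number `M` of extreme points is
known, then `M` confirmed indices are all of them (`semiDec_extIndices_eq`), and missing a closed
ball becomes a finite conjunction of open conditions. Since `M` lies between `2` and `N`, advice
with `N - 1` values suffices.

For the lower bound, a continuous realizer on a part `D` forces extreme indices to be upper
semicontinuous along `D`: a ball excluded after finitely many symbols stays excluded for nearby
tuples in `D` (`eventually_extIndices_subset`). Points on the graph of a convex function with kinks
that can be switched on one at a time give levels `0, …, N - 2`. Each tuple of a level is a limit of
tuples of the next level, which have one extreme point more. No nearby tuple of a higher level can
share its part, so climbing the levels meets `N - 1` distinct parts (`exists_colours_of_levels`). -/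

theorem mem_extPts_of_forall_lt {d N : ℕ} {x : Fin N → Vec d} (f : Vec d →ₗ[ℝ] ℝ) {j : Fin N}
    (h : ∀ i, x i ≠ x j → f (x i) < f (x j)) : x j ∈ extPts x := by
  -- An open halfspace with one boundary point adjoined is still convex, hence contains the whole
  -- hull. So `x j` is the only maximizer of `f` on the hull, and without it the hull lies in the
  -- open halfspace.
  have hconv : Convex ℝ ({z : Vec d | z = x j ∨ f z < f (x j)}) := by
    intro y hy z hz a b ha hb hab
    rcases hy with rfl | hy
    · rcases hz with rfl | hz
      · left
        rw [← add_smul, hab, one_smul]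
      · rcases hb.eq_or_lt with rfl | hb
        · left
          simp_all
        · right
          have : f (x j) = a * f (x j) + b * f (x j) := by rw [← add_mul, hab, one_mul]
          simp only [map_add, map_smul, smul_eq_mul]
          nlinarith
    · rcases ha.eq_or_lt with rfl | ha
      · have hb1 : b = 1 := by linarith
        subst hb1
        simpa using hz
      · right
        have hz' : f z ≤ f (x j) := by
          rcases hz with rfl | hz
          exacts [le_rfl, hz.le]
        have : f (x j) = a * f (x j) + b * f (x j) := by rw [← add_mul, hab, one_mul]
        simp only [map_add, map_smul, smul_eq_mul]
        nlinarith
  have hsub : convexHull ℝ (Set.range x) ⊆ {z : Vec d | z = x j ∨ f z < f (x j)} := by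
    refine convexHull_min ?_ hconv
    rintro _ ⟨i, rfl⟩
    by_cases hi : x i = x j
    exacts [Or.inl hi, Or.inr (h i hi)]
  refine (convex_convexHull ℝ _).mem_extremePoints_iff_mem_sdiff_convexHull_sdiff.2
    ⟨subset_convexHull ℝ _ ⟨j, rfl⟩, fun hmem => ?_⟩
  have hhalf : convexHull ℝ (convexHull ℝ (Set.range x) \ {x j}) ⊆ {z | f z < f (x j)} := by
    refine convexHull_min ?_ (convex_halfSpace_lt f.isLinear _)
    rintro z ⟨hz, hne⟩
    exact (hsub hz).resolve_left hne
  exact lt_irrefl (f (x j)) (hhalf hmem)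

/-- The linear functional `z ↦ ∑ zᵢ uᵢ`. -/
noncomputable def dotFunctional {d : ℕ} (u : Fin d → ℝ) : Vec d →ₗ[ℝ] ℝ where
  toFun z := ∑ l, z l * u l
  map_add' y z := by simp [add_mul, Finset.sum_add_distrib]
  map_smul' a z := by simp [Finset.mul_sum, mul_assoc]

theorem dotFunctional_apply {d : ℕ} (u : Fin d → ℝ) (z : Vec d) :
    dotFunctional u z = ∑ l, z l * u l := rfl

/-- Hahn–Banach separates `x j` from the compact hull of the other points. The separating weight
vectors form an open set, which the dense rational vectors must meet. -/
theorem exists_rat_functional {d N : ℕ} (hd : 1 ≤ d) {x : Fin N → Vec d} {j : Fin N}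
    (h : x j ∈ extPts x) : ∃ u : Fin d → ℚ, u ≠ 0 ∧
      ∀ i, x i ≠ x j → ∑ l, x i l * (u l : ℝ) < ∑ l, x j l * (u l : ℝ) := by
  have hnot : x j ∉ convexHull ℝ (Set.range x \ {x j}) := fun hmem =>
    ((convex_convexHull ℝ _).mem_extremePoints_iff_mem_sdiff_convexHull_sdiff.1 h).2
      (convexHull_mono (Set.sdiff_subset_sdiff_left (subset_convexHull ℝ _)) hmem)
  have hfin : (Set.range x \ {x j}).Finite := (Set.finite_range x).sdiff
  obtain ⟨f, c, hf, hc⟩ := geometric_hahn_banach_closed_point (convex_convexHull ℝ _)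
    (hfin.isClosed_convexHull ℝ) hnot
  let O : Set (Fin d → ℝ) := {w | w ≠ 0 ∧
    ∀ i, x i ≠ x j → ∑ l, x i l * w l < ∑ l, x j l * w l}
  have hO : IsOpen O := by
    have h1 : IsOpen {w : Fin d → ℝ | w ≠ 0} := isOpen_ne
    have h2 : IsOpen {w : Fin d → ℝ | ∀ i, x i ≠ x j →
        ∑ l, x i l * w l < ∑ l, x j l * w l} := by
      have : {w : Fin d → ℝ | ∀ i, x i ≠ x j → ∑ l, x i l * w l < ∑ l, x j l * w l} =
          ⋂ i, {w : Fin d → ℝ | x i ≠ x j → ∑ l, x i l * w l < ∑ l, x j l * w l} := by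
        ext w
        simp
      rw [this]
      refine isOpen_iInter_of_finite fun i => ?_
      by_cases hi : x i = x j
      · simp [hi]
      · simp only [ne_eq, hi, not_false_eq_true, true_imp_iff]
        exact isOpen_lt (by fun_prop) (by fun_prop)
    exact h1.inter h2
  have hne : O.Nonempty := by
    -- If all points coincide, the inequalities are vacuous and any nonzero vector serves; one
    -- exists because `1 ≤ d`. Otherwise a strict inequality excludes the zero vector.
    by_cases hall : ∀ i, x i = x j
    · refine ⟨fun _ => 1, fun h0 => ?_, fun i hi => absurd (hall i) hi⟩
      simpa using congrFun h0 ⟨0, hd⟩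
    · push Not at hall
      obtain ⟨i, hi⟩ := hall
      have hlt : ∀ i, x i ≠ x j → ∑ l, x i l * f (EuclideanSpace.single l 1) <
          ∑ l, x j l * f (EuclideanSpace.single l 1) := by
        have hrep : ∀ z : Vec d, ∑ l, z l * f (EuclideanSpace.single l 1) = f z := by
          intro z
          have hz : z = ∑ l, z l • (EuclideanSpace.single l (1 : ℝ) : Vec d) := by
            ext k
            simp [Finset.sum_apply, Pi.single_apply]
          conv_rhs => rw [hz]
          simp
        intro i hi
        rw [hrep, hrep]
        exact (hf _ (subset_convexHull ℝ _ ⟨⟨i, rfl⟩, hi⟩)).trans hc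
      refine ⟨_, fun h0 => ?_, hlt⟩
      have := hlt i hi
      simp [fun l => congrFun h0 l] at this
  have hdense : DenseRange fun (q : Fin d → ℚ) (i : Fin d) => (q i : ℝ) :=
    DenseRange.piMap (f := fun (_ : Fin d) (q : ℚ) => (q : ℝ)) fun _ => Rat.denseRange_cast
  obtain ⟨q, hq1, hq2⟩ := hdense.exists_mem_open hO hne
  refine ⟨q, fun h0 => hq1 ?_, hq2⟩
  ext i
  simp [h0]

/-- The condition `u ≠ 0` can be dropped: `u = 0` qualifies only if all points equal `x j`, which is
then extreme. -/
theorem mem_extPts_iff_exists_rat {d N : ℕ} (hd : 1 ≤ d) {x : Fin N → Vec d} {j : Fin N} :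
    x j ∈ extPts x ↔ ∃ u : Fin d → ℚ,
      ∀ i, x i ≠ x j → ∑ l, x i l * (u l : ℝ) < ∑ l, x j l * (u l : ℝ) := by
  constructor
  · intro h
    obtain ⟨u, -, hu⟩ := exists_rat_functional hd h
    exact ⟨u, hu⟩
  · rintro ⟨u, hu⟩
    exact mem_extPts_of_forall_lt (dotFunctional fun l => (u l : ℝ)) hu

theorem exists_halfspace_of_mem_extPts {d N : ℕ} (hd : 1 ≤ d) {x : Fin N → Vec d} {y : Vec d}
    (hy : y ∈ extPts x) : ∃ (u : Fin d → ℚ) (t : ℝ), u ≠ 0 ∧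
      halfspace (fun i => (u i : ℝ)) t ∩ Set.range x = {y} ∧ ∃ j, y = x j := by
  obtain ⟨j, rfl⟩ := extPts_subset x hy
  obtain ⟨u, hu0, hu⟩ := exists_rat_functional hd hy
  refine ⟨u, ∑ l, x j l * (u l : ℝ), hu0, ?_, j, rfl⟩
  ext z
  constructor
  · rintro ⟨hz, i, rfl⟩
    by_contra hne
    exact not_lt.2 hz (hu i hne)
  · rintro rfl
    exact ⟨le_refl (∑ l, x j l * (u l : ℝ)), j, rfl⟩

theorem mem_extPts_of_halfspace {d N : ℕ} {x : Fin N → Vec d} {u : Fin d → ℝ} {t : ℝ} {j : Fin N}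
    (h : halfspace u t ∩ Set.range x = {x j}) : x j ∈ extPts x := by
  refine mem_extPts_of_forall_lt (dotFunctional u) fun i hi => ?_
  have hj : x j ∈ halfspace u t ∩ Set.range x := h ▸ rfl
  refine lt_of_lt_of_le (lt_of_not_ge fun hle => hi ?_) hj.1
  have : x i ∈ halfspace u t ∩ Set.range x := ⟨hle, i, rfl⟩
  rwa [h] at this

/-! ### Indices and number of the extreme points -/

theorem mem_extIndices {d N : ℕ} {x : Fin N → Vec d} {j : Fin N} :
    j ∈ extIndices x ↔ x j ∈ extPts x := by
  simp [extIndices]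

theorem extPts_eq_image {d N : ℕ} (x : Fin N → Vec d) :
    extPts x = x '' (extIndices x : Set (Fin N)) := by
  ext y
  constructor
  · intro hy
    obtain ⟨j, rfl⟩ := extPts_subset x hy
    exact ⟨j, mem_extIndices.2 hy, rfl⟩
  · rintro ⟨j, hj, rfl⟩
    exact mem_extIndices.1 hj

theorem card_extIndices {d N : ℕ} {x : Fin N → Vec d} (hx : Function.Injective x) :
    (extIndices x).card = (extPts x).ncard := by
  rw [extPts_eq_image, Set.ncard_image_of_injective _ hx, Set.ncard_coe_finset]

/-- By Krein–Milman the hull is the closed hull of its extreme points; with at most one of them it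
could not contain two distinct points. -/
theorem two_le_ncard_extPts {d N : ℕ} (hN : 2 ≤ N) {x : Fin N → Vec d}
    (hx : Function.Injective x) : 2 ≤ (extPts x).ncard := by
  by_contra hlt
  have hfin : (extPts x).Finite := (Set.finite_range x).subset (extPts_subset x)
  have hsub : (extPts x).Subsingleton := by
    rw [← Set.encard_le_one_iff_subsingleton, ← hfin.cast_ncard_eq]
    exact_mod_cast (by omega : (extPts x).ncard ≤ 1)
  have hcl := closure_convexHull_extremePoints (s := convexHull ℝ (Set.range x))
    ((Set.finite_range x).isCompact_convexHull ℝ) (convex_convexHull ℝ _)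
  have hss : (convexHull ℝ (Set.range x)).Subsingleton := by
    rw [← hcl]
    change (closure (convexHull ℝ (extPts x))).Subsingleton
    rcases hsub.eq_empty_or_singleton with h | ⟨a, h⟩ <;> simp [h]
  have := hx (hss (subset_convexHull ℝ _ ⟨⟨0, by omega⟩, rfl⟩)
    (subset_convexHull ℝ _ ⟨⟨1, by omega⟩, rfl⟩))
  simp at this

theorem ncard_extPts_le {d N : ℕ} {x : Fin N → Vec d} (hx : Function.Injective x) :
    (extPts x).ncard ≤ N := by
  rw [← card_extIndices hx]
  simpa using (extIndices x).card_le_univ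

/-- On the line an extreme point is a strict maximum or a strict minimum, and among three of them
two would be of the same kind. -/
theorem ncard_extPts_of_one_dim {N : ℕ} (hN : 2 ≤ N) {x : Fin N → Vec 1}
    (hx : Function.Injective x) : (extPts x).ncard = 2 := by
  refine le_antisymm ?_ (two_le_ncard_extPts hN hx)
  rw [← card_extIndices hx]
  have key : ∀ j ∈ extIndices x, (∀ i ≠ j, x i 0 < x j 0) ∨ ∀ i ≠ j, x j 0 < x i 0 := by
    intro j hj
    obtain ⟨u, hu0, hu⟩ := exists_rat_functional le_rfl (mem_extIndices.1 hj)
    have hu00 : (u 0 : ℝ) ≠ 0 := fun h => hu0 (by ext i; fin_cases i; exact_mod_cast h)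
    rcases hu00.lt_or_gt with hneg | hpos
    · right
      intro i hi
      have := hu i (hx.ne hi)
      simp only [Fin.sum_univ_one] at this
      nlinarith
    · left
      intro i hi
      have := hu i (hx.ne hi)
      simp only [Fin.sum_univ_one] at this
      exact lt_of_mul_lt_mul_right this hpos.le
  by_contra hcard
  obtain ⟨a, ha, b, hb, c, hc, hab, hac, hbc⟩ := Finset.two_lt_card.1 (not_le.1 hcard)
  rcases key a ha with ha | ha <;> rcases key b hb with hb | hb <;> rcases key c hc with hc | hc <;>
    first
    | exact lt_asymm (ha b hab.symm) (hb a hab)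
    | exact lt_asymm (ha c hac.symm) (hc a hac)
    | exact lt_asymm (hb c hbc.symm) (hc b hbc)

/-! ### Points on the graph of a piecewise linear convex function -/

/-- The planar point `(a, b)` in `ℝ^d`. -/
noncomputable def planar (d : ℕ) (a b : ℝ) : Vec d :=
  WithLp.toLp 2 fun l => if (l : ℕ) = 0 then a else if (l : ℕ) = 1 then b else 0

/-- The points `(i, ∑ εₘ |i - m|)`; those with `0 < m < N - 1` and `εₘ = 0` lie on
the segment between their neighbours. -/
noncomputable def kinked (d N : ℕ) (ε : Fin N → ℝ) (i : Fin N) : Vec d :=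
  planar d (i : ℕ) (∑ m, ε m * |((i : ℕ) : ℝ) - (m : ℕ)|)

theorem kinked_injective {d N : ℕ} (hd : 2 ≤ d) (ε : Fin N → ℝ) :
    Function.Injective (kinked d N ε) := by
  intro i j h
  have := congrFun (congrArg WithLp.ofLp h) ⟨0, by omega⟩
  simp only [kinked, planar, if_true] at this
  exact Fin.ext (by exact_mod_cast this)

theorem continuous_kinked (d N : ℕ) : Continuous (kinked d N) := by
  refine continuous_pi fun i => ?_
  unfold kinked planar
  refine (PiLp.continuous_toLp 2 _).comp (continuous_pi fun l => ?_)
  split_ifs <;> fun_prop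

theorem dotFunctional_planar {d : ℕ} (hd : 2 ≤ d) (s t a b : ℝ) :
    dotFunctional (fun l : Fin d => if (l : ℕ) = 0 then s else if (l : ℕ) = 1 then t else 0)
      (planar d a b) = a * s + b * t := by
  obtain ⟨d, rfl⟩ := Nat.exists_eq_add_of_le' hd
  simp [dotFunctional_apply, planar, Fin.sum_univ_succ]

/-- At an inner index without a kink the function is affine on `[j - 1, j + 1]`, so the point is the
midpoint of its neighbours. The two ends are exposed by the first coordinate, a kink by a supporting
line that touches the graph only there. -/
theorem mem_extIndices_kinked {d N : ℕ} (hd : 2 ≤ d) {ε : Fin N → ℝ} (hε : ∀ m, 0 ≤ ε m)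
    (j : Fin N) :
    j ∈ extIndices (kinked d N ε) ↔ (j : ℕ) = 0 ∨ (j : ℕ) + 1 = N ∨ 0 < ε j := by
  rw [mem_extIndices]
  constructor
  · intro h
    by_contra! hcon
    obtain ⟨h0, h1, h2⟩ := hcon
    have hεj : ε j = 0 := le_antisymm h2 (hε j)
    have hj := j.2
    let a : Fin N := ⟨j - 1, by omega⟩
    let b : Fin N := ⟨j + 1, by omega⟩
    have ha : ((a : ℕ) : ℝ) = (j : ℕ) - 1 := by
      simp only [a]
      rw [Nat.cast_sub (by omega)]
      simp
    have hb : ((b : ℕ) : ℝ) = (j : ℕ) + 1 := by simp [b]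
    have hsum : ∑ m, ε m * |((j : ℕ) : ℝ) - (m : ℕ)| =
        1 / 2 * (∑ m, ε m * |((a : ℕ) : ℝ) - (m : ℕ)|) +
        1 / 2 * (∑ m, ε m * |((b : ℕ) : ℝ) - (m : ℕ)|) := by
      rw [Finset.mul_sum, Finset.mul_sum, ← Finset.sum_add_distrib]
      refine Finset.sum_congr rfl fun m _ => ?_
      rw [ha, hb]
      rcases lt_trichotomy (m : ℕ) (j : ℕ) with h | h | h
      · have : ((m : ℕ) : ℝ) + 1 ≤ (j : ℕ) := by exact_mod_cast h
        rw [abs_of_nonneg (by linarith), abs_of_nonneg (by linarith), abs_of_nonneg (by linarith)]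
        ring
      · rw [Fin.ext h, hεj]
        ring
      · have : ((j : ℕ) : ℝ) + 1 ≤ (m : ℕ) := by exact_mod_cast h
        rw [abs_of_nonpos (by linarith), abs_of_nonpos (by linarith), abs_of_nonpos (by linarith)]
        ring
    have hmem : kinked d N ε j ∈ openSegment ℝ (kinked d N ε a) (kinked d N ε b) := by
      refine ⟨1 / 2, 1 / 2, by norm_num, by norm_num, by norm_num, ?_⟩
      ext l
      simp only [kinked, planar, PiLp.add_apply, PiLp.smul_apply, smul_eq_mul]
      split_ifs
      · rw [ha, hb]
        ring
      · exact hsum.symm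
      · ring
    have := kinked_injective hd ε (h.2 (subset_convexHull ℝ _ ⟨a, rfl⟩)
      (subset_convexHull ℝ _ ⟨b, rfl⟩) hmem)
    have := congrArg Fin.val this
    simp only [a] at this
    omega
  · intro h
    have hneq : ∀ i : Fin N, kinked d N ε i ≠ kinked d N ε j → (i : ℕ) ≠ j :=
      fun i hi h => hi (by rw [Fin.ext h])
    rcases h with h | h | h
    · refine mem_extPts_of_forall_lt (dotFunctional fun l : Fin d =>
        if (l : ℕ) = 0 then -1 else if (l : ℕ) = 1 then 0 else 0) fun i hi => ?_
      simp only [kinked, dotFunctional_planar hd]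
      have : ((j : ℕ) : ℝ) < (i : ℕ) := by
        have := hneq i hi
        exact_mod_cast (by omega : (j : ℕ) < i)
      linarith
    · refine mem_extPts_of_forall_lt (dotFunctional fun l : Fin d =>
        if (l : ℕ) = 0 then 1 else if (l : ℕ) = 1 then 0 else 0) fun i hi => ?_
      simp only [kinked, dotFunctional_planar hd]
      have : ((i : ℕ) : ℝ) < (j : ℕ) := by
        have := hneq i hi
        exact_mod_cast (by omega : (i : ℕ) < j)
      linarith
    -- `σ m` is a subgradient of `t ↦ |t - m|` at `j`, so `∑ m, ε m * σ m` is the slope of a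
    -- supporting line. For `m = j` the value `0` is interior to `[-1, 1]`, which makes the
    -- inequality strict for `i ≠ j`.
    · let σ : Fin N → ℝ := fun m => if (m : ℕ) < j then 1 else if (j : ℕ) < m then -1 else 0
      refine mem_extPts_of_forall_lt (dotFunctional fun l : Fin d =>
        if (l : ℕ) = 0 then ∑ m, ε m * σ m else if (l : ℕ) = 1 then -1 else 0) fun i hi => ?_
      simp only [kinked, dotFunctional_planar hd]
      have key : ∑ m, ε m * (|((j : ℕ) : ℝ) - (m : ℕ)| + σ m * (((i : ℕ) : ℝ) - (j : ℕ))) <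
          ∑ m, ε m * |((i : ℕ) : ℝ) - (m : ℕ)| := by
        refine Finset.sum_lt_sum (fun m _ => mul_le_mul_of_nonneg_left ?_ (hε m))
          ⟨j, Finset.mem_univ _, mul_lt_mul_of_pos_left ?_ h⟩
        · simp only [σ]
          split_ifs with h1 h2
          · have : ((m : ℕ) : ℝ) < (j : ℕ) := by exact_mod_cast h1
            rw [abs_of_pos (by linarith)]
            linarith [le_abs_self (((i : ℕ) : ℝ) - (m : ℕ))]
          · have : ((j : ℕ) : ℝ) < (m : ℕ) := by exact_mod_cast h2
            rw [abs_of_neg (by linarith)]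
            linarith [neg_abs_le (((i : ℕ) : ℝ) - (m : ℕ))]
          · have : (m : ℕ) = j := by omega
            simp [this]
        · have : ((i : ℕ) : ℝ) ≠ (j : ℕ) := by exact_mod_cast hneq i hi
          simpa [σ, sub_eq_zero] using this
      simp only [mul_add, Finset.sum_add_distrib] at key
      have hs : ∑ m, ε m * (σ m * (((i : ℕ) : ℝ) - (j : ℕ))) =
          (∑ m, ε m * σ m) * (((i : ℕ) : ℝ) - (j : ℕ)) := by
        rw [Finset.sum_mul]
        exact Finset.sum_congr rfl fun m _ => by ring
      rw [hs] at key
      linarith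

theorem ncard_extPts_kinked {d N m : ℕ} (hd : 2 ≤ d) (hm : m + 2 ≤ N) {ε : Fin N → ℝ}
    (hε : ∀ l, 0 ≤ ε l) (hpos : ∀ l, 0 < ε l ↔ 1 ≤ (l : ℕ) ∧ (l : ℕ) ≤ m) :
    (extPts (kinked d N ε)).ncard = m + 2 := by
  rw [← card_extIndices (kinked_injective hd ε)]
  -- Index `0` and the kinks `1, …, m` fill `range (m + 1)`; the other end `N - 1` is a further
  -- index because `m + 2 ≤ N`.
  have himage : (extIndices (kinked d N ε)).image Fin.val =
      insert (N - 1) (Finset.range (m + 1)) := by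
    ext k
    simp only [Finset.mem_image, mem_extIndices_kinked hd hε, hpos, Finset.mem_insert,
      Finset.mem_range]
    constructor
    · rintro ⟨j, hj, rfl⟩
      omega
    · intro hk
      exact ⟨⟨k, by omega⟩, by simp only; omega, rfl⟩
  rw [← Finset.card_image_of_injective _ Fin.val_injective, himage,
    Finset.card_insert_of_notMem (by simp; omega), Finset.card_range]

/-! ### Primitive recursive arithmetic on codes of rationals -/

/-- The code of `(a - b) / (c + 1)`. -/
def ratCode (a b c : ℕ) : ℕ := Nat.pair a (Nat.pair b c)

/-- The positive part `a` of the numerator of the code of `(a - b) / (c + 1)`. -/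
def codePos (n : ℕ) : ℕ := n.unpair.1

/-- The negative part `b` of the numerator of the code of `(a - b) / (c + 1)`. -/
def codeNeg (n : ℕ) : ℕ := n.unpair.2.unpair.1

/-- The predecessor `c` of the denominator of the code of `(a - b) / (c + 1)`. -/
def codeDen (n : ℕ) : ℕ := n.unpair.2.unpair.2

theorem ratOf_eq (n : ℕ) : ratOf n = ((codePos n : ℚ) - codeNeg n) / (codeDen n + 1) := rfl

theorem ratOf_ratCode (a b c : ℕ) : ratOf (ratCode a b c) = ((a : ℚ) - b) / (c + 1) := by
  simp [ratOf, ratCode]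

theorem primrec_codePos : Primrec codePos := Primrec.fst.comp Primrec.unpair

theorem primrec_codeNeg : Primrec codeNeg :=
  Primrec.fst.comp (Primrec.unpair.comp (Primrec.snd.comp Primrec.unpair))

theorem primrec_codeDen : Primrec codeDen :=
  Primrec.snd.comp (Primrec.unpair.comp (Primrec.snd.comp Primrec.unpair))

theorem primrec_ratCode {α : Type*} [Primcodable α] {a b c : α → ℕ} (ha : Primrec a)
    (hb : Primrec b) (hc : Primrec c) : Primrec fun x => ratCode (a x) (b x) (c x) :=
  Primrec₂.natPair.comp ha (Primrec₂.natPair.comp hb hc)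

/-- Addition on codes of rationals. -/
def addCode (m n : ℕ) : ℕ :=
  ratCode (codePos m * (codeDen n + 1) + codePos n * (codeDen m + 1))
    (codeNeg m * (codeDen n + 1) + codeNeg n * (codeDen m + 1))
    (codeDen m * codeDen n + codeDen m + codeDen n)

/-- Multiplication on codes of rationals. -/
def mulCode (m n : ℕ) : ℕ :=
  ratCode (codePos m * codePos n + codeNeg m * codeNeg n)
    (codePos m * codeNeg n + codeNeg m * codePos n)
    (codeDen m * codeDen n + codeDen m + codeDen n)

/-- Negation on codes of rationals. -/
def negCode (m : ℕ) : ℕ := ratCode (codeNeg m) (codePos m) (codeDen m)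

/-- The absolute value on codes of rationals. -/
def absCode (m : ℕ) : ℕ :=
  ratCode ((codePos m - codeNeg m) + (codeNeg m - codePos m)) 0 (codeDen m)

/-- A code of `2⁻ⁿ`. -/
def halfPowCode (n : ℕ) : ℕ := ratCode 1 0 (2 ^ n - 1)

theorem ratOf_addCode (m n : ℕ) : ratOf (addCode m n) = ratOf m + ratOf n := by
  rw [addCode, ratOf_ratCode, ratOf_eq, ratOf_eq]
  push_cast
  have h1 : (codeDen m : ℚ) + 1 ≠ 0 := by positivity
  have h2 : (codeDen n : ℚ) + 1 ≠ 0 := by positivity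
  -- Codes store the predecessor of the denominator, so the product of the denominators appears with
  -- `1` subtracted.
  have h3 : (codeDen m * codeDen n + codeDen m + codeDen n : ℚ) + 1 =
    (codeDen m + 1) * (codeDen n + 1) := by ring
  rw [h3]
  field_simp
  ring

theorem ratOf_mulCode (m n : ℕ) : ratOf (mulCode m n) = ratOf m * ratOf n := by
  rw [mulCode, ratOf_ratCode, ratOf_eq, ratOf_eq]
  push_cast
  have h3 : (codeDen m * codeDen n + codeDen m + codeDen n : ℚ) + 1 =
    (codeDen m + 1) * (codeDen n + 1) := by ring
  rw [h3, div_mul_div_comm]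
  congr 1
  ring

theorem ratOf_negCode (m : ℕ) : ratOf (negCode m) = -ratOf m := by
  rw [negCode, ratOf_ratCode, ratOf_eq]
  ring

theorem ratOf_absCode (m : ℕ) : ratOf (absCode m) = |ratOf m| := by
  rw [absCode, ratOf_ratCode, ratOf_eq, abs_div, abs_of_pos (show (codeDen m : ℚ) + 1 > 0 by
    positivity)]
  congr 1
  rcases le_total (codePos m) (codeNeg m) with h | h
  · rw [Nat.sub_eq_zero_of_le h, abs_of_nonpos (sub_nonpos.2 (by exact_mod_cast h))]
    push_cast [h]
    ring
  · rw [Nat.sub_eq_zero_of_le h, abs_of_nonneg (sub_nonneg.2 (by exact_mod_cast h))]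
    push_cast [h]
    ring

theorem ratOf_halfPowCode (n : ℕ) : ratOf (halfPowCode n) = (1 / 2) ^ n := by
  rw [halfPowCode, ratOf_ratCode, Nat.cast_sub Nat.one_le_two_pow]
  simp

theorem ratOf_pos_iff (m : ℕ) : 0 < ratOf m ↔ codeNeg m < codePos m := by
  rw [ratOf_eq, div_pos_iff_of_pos_right (by positivity), sub_pos, Nat.cast_lt]

theorem primrec_addCode : Primrec₂ addCode := by
  have p1 := (primrec_codePos.comp (Primrec.fst : Primrec (Prod.fst : ℕ × ℕ → ℕ)))
  have p2 := (primrec_codePos.comp (Primrec.snd : Primrec (Prod.snd : ℕ × ℕ → ℕ)))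
  have n1 := (primrec_codeNeg.comp (Primrec.fst : Primrec (Prod.fst : ℕ × ℕ → ℕ)))
  have n2 := (primrec_codeNeg.comp (Primrec.snd : Primrec (Prod.snd : ℕ × ℕ → ℕ)))
  have d1 := (primrec_codeDen.comp (Primrec.fst : Primrec (Prod.fst : ℕ × ℕ → ℕ)))
  have d2 := (primrec_codeDen.comp (Primrec.snd : Primrec (Prod.snd : ℕ × ℕ → ℕ)))
  exact primrec_ratCode
    (Primrec.nat_add.comp (Primrec.nat_mul.comp p1 (Primrec.succ.comp d2))
      (Primrec.nat_mul.comp p2 (Primrec.succ.comp d1)))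
    (Primrec.nat_add.comp (Primrec.nat_mul.comp n1 (Primrec.succ.comp d2))
      (Primrec.nat_mul.comp n2 (Primrec.succ.comp d1)))
    (Primrec.nat_add.comp (Primrec.nat_add.comp (Primrec.nat_mul.comp d1 d2) d1) d2)

theorem primrec_mulCode : Primrec₂ mulCode := by
  have p1 := (primrec_codePos.comp (Primrec.fst : Primrec (Prod.fst : ℕ × ℕ → ℕ)))
  have p2 := (primrec_codePos.comp (Primrec.snd : Primrec (Prod.snd : ℕ × ℕ → ℕ)))
  have n1 := (primrec_codeNeg.comp (Primrec.fst : Primrec (Prod.fst : ℕ × ℕ → ℕ)))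
  have n2 := (primrec_codeNeg.comp (Primrec.snd : Primrec (Prod.snd : ℕ × ℕ → ℕ)))
  have d1 := (primrec_codeDen.comp (Primrec.fst : Primrec (Prod.fst : ℕ × ℕ → ℕ)))
  have d2 := (primrec_codeDen.comp (Primrec.snd : Primrec (Prod.snd : ℕ × ℕ → ℕ)))
  exact primrec_ratCode
    (Primrec.nat_add.comp (Primrec.nat_mul.comp p1 p2) (Primrec.nat_mul.comp n1 n2))
    (Primrec.nat_add.comp (Primrec.nat_mul.comp p1 n2) (Primrec.nat_mul.comp n1 p2))
    (Primrec.nat_add.comp (Primrec.nat_add.comp (Primrec.nat_mul.comp d1 d2) d1) d2)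

theorem primrec_negCode : Primrec negCode :=
  primrec_ratCode primrec_codeNeg primrec_codePos primrec_codeDen

theorem primrec_absCode : Primrec absCode :=
  primrec_ratCode (Primrec.nat_add.comp (Primrec.nat_sub.comp primrec_codePos primrec_codeNeg)
    (Primrec.nat_sub.comp primrec_codeNeg primrec_codePos)) (Primrec.const 0) primrec_codeDen

theorem primrec_halfPowCode : Primrec halfPowCode := by
  have hpow : Primrec₂ ((· ^ ·) : ℕ → ℕ → ℕ) := Primrec₂.unpaired'.1 Nat.Primrec.pow
  exact primrec_ratCode (Primrec.const 1) (Primrec.const 0)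
    (Primrec.nat_sub.comp (hpow.comp (Primrec.const 2) Primrec.id) (Primrec.const 1))

/-! ### Prefixes -/

@[simp]
theorem length_pre (p : Name) (n : ℕ) : (pre p n).length = n := by simp [pre]

theorem getD_pre {p : Name} {n i : ℕ} (h : i < n) (a : ℕ) : (pre p n).getD i a = p i := by
  simp [pre, h]

theorem take_pre {p : Name} {m n : ℕ} (h : m ≤ n) : (pre p n).take m = pre p m := by
  rw [pre, pre, ← List.map_take, List.take_range, min_eq_left h]

/-! ### Real functions approximable from a name

`R p x` means that `p` is an admissible name of `x`; a real function `f x a` depends in addition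
on a discrete parameter `a`. -/

section

variable {X σ : Type*} [Primcodable σ] {R : Name → X → Prop}

/-- From the prefixes of a name of `x` and from `a` one computes rational midpoints and
radii of intervals that contain `f x a` and shrink to it. -/
def Approximable (R : Name → X → Prop) (f : X → σ → ℝ) : Prop :=
  ∃ m e : List ℕ → σ → ℕ, Primrec₂ m ∧ Primrec₂ e ∧ ∃ n₀, ∀ p x, R p x → ∀ a,
    (∀ n ≥ n₀, |f x a - (ratOf (m (pre p n) a) : ℝ)| ≤ ratOf (e (pre p n) a)) ∧
    Tendsto (fun n => (ratOf (e (pre p n) a) : ℝ)) atTop (𝓝 0)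

theorem tendsto_of_abs_sub_le {y : ℝ} {m e : ℕ → ℝ} {n₀ : ℕ} (h : ∀ n ≥ n₀, |y - m n| ≤ e n)
    (he : Tendsto e atTop (𝓝 0)) : Tendsto m atTop (𝓝 y) := by
  rw [tendsto_iff_dist_tendsto_zero]
  refine squeeze_zero' (Eventually.of_forall fun _ => dist_nonneg) ?_ he
  filter_upwards [eventually_ge_atTop n₀] with n hn
  rw [dist_comm]
  exact h n hn

theorem approximable_ratOf {g : σ → ℕ} (hg : Primrec g) :
    Approximable R fun _ a => (ratOf (g a) : ℝ) := by
  refine ⟨fun _ a => g a, fun _ _ => ratCode 0 0 0, hg.comp Primrec.snd, Primrec₂.const _, 0,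
    fun p x _ a => ⟨fun n _ => ?_, ?_⟩⟩ <;> simp [ratOf_ratCode]

theorem Approximable.neg {f : X → σ → ℝ} (hf : Approximable R f) :
    Approximable R fun x a => -f x a := by
  obtain ⟨m, e, hm, he, n₀, h⟩ := hf
  refine ⟨fun w a => negCode (m w a), e, primrec_negCode.comp hm, he, n₀,
    fun p x hp a => ⟨fun n hn => ?_, (h p x hp a).2⟩⟩
  refine le_of_eq_of_le ?_ ((h p x hp a).1 n hn)
  rw [ratOf_negCode, ← abs_neg]
  congr 1
  push_cast
  ring

theorem Approximable.add {f g : X → σ → ℝ} (hf : Approximable R f) (hg : Approximable R g) :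
    Approximable R fun x a => f x a + g x a := by
  obtain ⟨m, e, hm, he, n₀, h⟩ := hf
  obtain ⟨m', e', hm', he', n₁, h'⟩ := hg
  refine ⟨fun w a => addCode (m w a) (m' w a), fun w a => addCode (e w a) (e' w a),
    primrec_addCode.comp hm hm', primrec_addCode.comp he he', max n₀ n₁,
    fun p x hp a => ⟨fun n hn => ?_, ?_⟩⟩
  · have h1 := (h p x hp a).1 n (le_of_max_le_left hn)
    have h2 := (h' p x hp a).1 n (le_of_max_le_right hn)
    rw [ratOf_addCode, ratOf_addCode]
    push_cast
    rw [abs_le] at *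
    constructor <;> linarith
  · simp only [ratOf_addCode, Rat.cast_add]
    simpa using (h p x hp a).2.add (h' p x hp a).2

/-- The error bound uses only computed quantities: the midpoints and radii of the factors. It tends
to zero because the midpoints converge, hence stay bounded. -/
theorem Approximable.mul {f g : X → σ → ℝ} (hf : Approximable R f) (hg : Approximable R g) :
    Approximable R fun x a => f x a * g x a := by
  obtain ⟨m, e, hm, he, n₀, h⟩ := hf
  obtain ⟨m', e', hm', he', n₁, h'⟩ := hg
  refine ⟨fun w a => mulCode (m w a) (m' w a),
    fun w a => addCode (mulCode (absCode (m w a)) (e' w a))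
      (addCode (mulCode (absCode (m' w a)) (e w a)) (mulCode (e w a) (e' w a))),
    primrec_mulCode.comp hm hm',
    primrec_addCode.comp (primrec_mulCode.comp (primrec_absCode.comp hm) he')
      (primrec_addCode.comp (primrec_mulCode.comp (primrec_absCode.comp hm') he)
        (primrec_mulCode.comp he he')), max n₀ n₁,
    fun p x hp a => ⟨fun n hn => ?_, ?_⟩⟩
  · have h1 := (h p x hp a).1 n (le_of_max_le_left hn)
    have h2 := (h' p x hp a).1 n (le_of_max_le_right hn)
    simp only [ratOf_addCode, ratOf_mulCode, ratOf_absCode]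
    push_cast
    generalize (ratOf (m (pre p n) a) : ℝ) = μ at *
    generalize (ratOf (m' (pre p n) a) : ℝ) = μ' at *
    calc |f x a * g x a - μ * μ'|
        = |μ * (g x a - μ') + (μ' * (f x a - μ) + (f x a - μ) * (g x a - μ'))| := by
          congr 1
          ring
      _ ≤ |μ * (g x a - μ')| + (|μ' * (f x a - μ)| + |(f x a - μ) * (g x a - μ')|) :=
          (abs_add_le _ _).trans (add_le_add_right (abs_add_le _ _) _)
      _ ≤ _ := by
          simp only [abs_mul]
          have := (abs_nonneg _).trans h1
          gcongr
  · simp only [ratOf_addCode, ratOf_mulCode, ratOf_absCode]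
    push_cast
    have t1 := (tendsto_of_abs_sub_le (h p x hp a).1 (h p x hp a).2).abs
    have t2 := (tendsto_of_abs_sub_le (h' p x hp a).1 (h' p x hp a).2).abs
    have t3 := (h p x hp a).2
    have t4 := (h' p x hp a).2
    simpa using (t1.mul t4).add ((t2.mul t3).add (t3.mul t4))

theorem Approximable.sub {f g : X → σ → ℝ} (hf : Approximable R f) (hg : Approximable R g) :
    Approximable R fun x a => f x a - g x a := by
  simpa only [sub_eq_add_neg] using hf.add hg.neg

theorem Approximable.sum {ι : Type*} (s : Finset ι) {f : ι → X → σ → ℝ}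
    (hf : ∀ i, Approximable R (f i)) : Approximable R fun x a => ∑ i ∈ s, f i x a := by
  classical
  induction s using Finset.induction_on with
  | empty =>
    simpa [ratOf_ratCode] using
      approximable_ratOf (R := R) (Primrec.const (α := σ) (ratCode 0 0 0))
  | insert i s hi ih =>
    simp only [Finset.sum_insert hi]
    exact (hf i).add ih

/-! ### Semi-decidable relations -/

/-- The relation `U x a` is recognized, for a name of `x` and for a discrete parameter `a`,
by a primitive recursive test on prefixes that stays positive from some point on. -/
def SemiDec (R : Name → X → Prop) (U : X → σ → Prop) : Prop :=
  ∃ T : List ℕ → σ → Prop, PrimrecRel T ∧ ∀ p x, R p x → ∀ a,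
    (∀ n, T (pre p n) a → U x a) ∧ (U x a → ∀ᶠ n in atTop, T (pre p n) a)

theorem SemiDec.congr {U V : X → σ → Prop} (hU : SemiDec R U)
    (h : ∀ p x, R p x → ∀ a, U x a ↔ V x a) : SemiDec R V := by
  obtain ⟨T, hT, hU⟩ := hU
  refine ⟨T, hT, fun p x hp a => ?_⟩
  rw [← h p x hp a]
  exact hU p x hp a

theorem SemiDec.map {Y : Type*} {R' : Name → Y → Prop} {U : X → σ → Prop} (hU : SemiDec R U)
    (g : Y → X) (h : ∀ p y, R' p y → R p (g y)) : SemiDec R' fun y a => U (g y) a := by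
  obtain ⟨T, hT, hU⟩ := hU
  exact ⟨T, hT, fun p y hp a => hU p (g y) (h p y hp) a⟩

theorem semiDec_of_primrecPred {V : σ → Prop} (hV : PrimrecPred V) :
    SemiDec R fun _ a => V a :=
  ⟨fun _ a => V a, hV.comp Primrec.snd, fun _ _ _ _ =>
    ⟨fun _ h => h, fun h => Eventually.of_forall fun _ => h⟩⟩

/-- The test asks whether midpoint minus radius is positive. This is sound once the interval is
valid, hence the check of the length against `n₀`, and it eventually succeeds because the difference
converges to `f x a`. -/
theorem Approximable.semiDec_pos {f : X → σ → ℝ} (hf : Approximable R f) :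
    SemiDec R fun x a => 0 < f x a := by
  obtain ⟨m, e, hm, he, n₀, h⟩ := hf
  have hc : Primrec fun z : List ℕ × σ => addCode (m z.1 z.2) (negCode (e z.1 z.2)) :=
    primrec_addCode.comp hm (primrec_negCode.comp he)
  refine ⟨fun w a => n₀ ≤ w.length ∧ codeNeg (addCode (m w a) (negCode (e w a))) <
    codePos (addCode (m w a) (negCode (e w a))),
    (Primrec.nat_le.comp (Primrec.const n₀) (Primrec.list_length.comp Primrec.fst)).and
    (Primrec.nat_lt.comp (primrec_codeNeg.comp hc) (primrec_codePos.comp hc)),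
    fun p x hp a => ?_⟩
  have hcast : ∀ n, codeNeg (addCode (m (pre p n) a) (negCode (e (pre p n) a))) <
      codePos (addCode (m (pre p n) a) (negCode (e (pre p n) a))) ↔
      (0 : ℝ) < ratOf (m (pre p n) a) - ratOf (e (pre p n) a) := by
    intro n
    rw [← ratOf_pos_iff, ratOf_addCode, ratOf_negCode, ← sub_eq_add_neg]
    exact_mod_cast Iff.rfl
  simp only [length_pre, hcast]
  constructor
  · rintro n ⟨hn, hlt⟩
    have := abs_le.1 ((h p x hp a).1 n hn)
    linarith
  · intro hpos
    have ht := (tendsto_of_abs_sub_le (h p x hp a).1 (h p x hp a).2).sub (h p x hp a).2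
    rw [sub_zero] at ht
    exact (eventually_ge_atTop n₀).and (ht.eventually_const_lt hpos)

theorem SemiDec.and {U V : X → σ → Prop} (hU : SemiDec R U) (hV : SemiDec R V) :
    SemiDec R fun x a => U x a ∧ V x a := by
  obtain ⟨T, hT, hU⟩ := hU
  obtain ⟨S, hS, hV⟩ := hV
  exact ⟨fun w a => T w a ∧ S w a, PrimrecPred.and hT hS, fun p x hp a =>
    ⟨fun n h => ⟨(hU p x hp a).1 n h.1, (hV p x hp a).1 n h.2⟩,
      fun h => ((hU p x hp a).2 h.1).and ((hV p x hp a).2 h.2)⟩⟩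

theorem SemiDec.or {U V : X → σ → Prop} (hU : SemiDec R U) (hV : SemiDec R V) :
    SemiDec R fun x a => U x a ∨ V x a := by
  obtain ⟨T, hT, hU⟩ := hU
  obtain ⟨S, hS, hV⟩ := hV
  exact ⟨fun w a => T w a ∨ S w a, PrimrecPred.or hT hS, fun p x hp a =>
    ⟨fun n h => h.imp ((hU p x hp a).1 n) ((hV p x hp a).1 n),
      fun h => h.elim (fun h => ((hU p x hp a).2 h).mono fun _ => Or.inl)
        fun h => ((hV p x hp a).2 h).mono fun _ => Or.inr⟩⟩

theorem semiDec_true : SemiDec R fun (_ : X) (_ : σ) => True :=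
  semiDec_of_primrecPred (Primrec.primrecPred (by simpa using Primrec.const true))

theorem semiDec_false : SemiDec R fun (_ : X) (_ : σ) => False :=
  semiDec_of_primrecPred (Primrec.primrecPred (by simpa using Primrec.const false))

theorem SemiDec.forall_finset {ι : Type*} (s : Finset ι) {U : ι → X → σ → Prop}
    (hU : ∀ i ∈ s, SemiDec R (U i)) : SemiDec R fun x a => ∀ i ∈ s, U i x a := by
  classical
  induction s using Finset.induction_on with
  | empty => simpa using semiDec_true
  | insert i s hi ih =>
    simp only [Finset.forall_mem_insert]
    exact (hU i (Finset.mem_insert_self _ _)).and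
      (ih fun k hk => hU k (Finset.mem_insert_of_mem hk))

theorem SemiDec.exists_finset {ι : Type*} (s : Finset ι) {U : ι → X → σ → Prop}
    (hU : ∀ i, SemiDec R (U i)) : SemiDec R fun x a => ∃ i ∈ s, U i x a := by
  classical
  induction s using Finset.induction_on with
  | empty => simpa using semiDec_false
  | insert i s hi ih =>
    simp only [Finset.exists_mem_insert]
    exact (hU i).or ih

/-- Bounding the witness by the length of the prefix keeps the test primitive recursive. A fixed
witness comes within the bound and, by the persistence demanded in `SemiDec`, continues to pass. -/
theorem SemiDec.exists_nat {U : X → σ × ℕ → Prop} (hU : SemiDec R U) :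
    SemiDec R fun x a => ∃ b, U x (a, b) := by
  obtain ⟨T, hT, hU⟩ := hU
  have hT' : PrimrecRel fun (b : ℕ) (z : List ℕ × σ) => T z.1 (z.2, b) :=
    hT.comp (Primrec.fst.comp Primrec.snd)
      (Primrec.pair (Primrec.snd.comp Primrec.snd) Primrec.fst)
  have hT'' : PrimrecPred fun z : List ℕ × σ => ∃ b < z.1.length, T z.1 (z.2, b) := by
    simpa only [List.mem_range, id] using hT'.exists_mem_list.comp
      (Primrec.list_range.comp (Primrec.list_length.comp Primrec.fst)) Primrec.id
  refine ⟨fun w a => ∃ b < w.length, T w (a, b), hT'', fun p x hp a => ⟨?_, ?_⟩⟩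
  · rintro n ⟨b, -, hb⟩
    exact ⟨b, (hU p x hp (a, b)).1 n hb⟩
  · rintro ⟨b, hb⟩
    filter_upwards [eventually_gt_atTop b, (hU p x hp (a, b)).2 hb] with n h1 h2
    exact ⟨b, by simpa using h1, h2⟩

/-- The word of the symbols at even positions. -/
def evens (w : List ℕ) : List ℕ := (List.range (w.length / 2)).map fun n => w.getD (2 * n) 0

theorem evens_pre (p : Name) (n : ℕ) : evens (pre p n) = pre (fun i => p (2 * i)) (n / 2) := by
  rw [evens, length_pre, pre]
  refine List.map_congr_left fun i hi => getD_pre ?_ 0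
  have := List.mem_range.1 hi
  omega

theorem primrec_evens : Primrec evens :=
  Primrec.list_map (Primrec.list_range.comp
    (Primrec.nat_div.comp Primrec.list_length (Primrec.const 2)))
    ((Primrec.list_getD 0).comp Primrec.fst
      (Primrec.nat_mul.comp (Primrec.const 2) Primrec.snd))

theorem SemiDec.evens {U : X → σ → Prop} (hU : SemiDec R U) :
    SemiDec (fun p x => R (fun n => p (2 * n)) x) U := by
  obtain ⟨T, hT, hU⟩ := hU
  refine ⟨fun w a => T (TTE.evens w) a, hT.comp (primrec_evens.comp Primrec.fst) Primrec.snd,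
    fun p x hp a => ?_⟩
  simp only [evens_pre]
  exact ⟨fun n h => (hU _ x hp a).1 _ h, fun h =>
    (tendsto_atTop.2 fun b => (eventually_ge_atTop (2 * b)).mono fun n hn => by omega :
      Tendsto (fun n => n / 2) atTop atTop).eventually ((hU _ x hp a).2 h)⟩

/-- A primitive recursive property of a number that is coded at a fixed position is decidable. -/
theorem semiDec_symbol {V : ℕ → σ → Prop} (hV : PrimrecRel V) (i : ℕ) {t : ℕ → ℕ}
    (ht : Primrec t) {M : X → ℕ} (hR : ∀ p x, R p x → t (p i) = M x) :
    SemiDec R fun x a => V (M x) a := by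
  refine ⟨fun w a => i < w.length ∧ V (t (w.getD i 0)) a,
    (Primrec.nat_lt.comp (Primrec.const i) (Primrec.list_length.comp Primrec.fst)).and
      (hV.comp (ht.comp ((Primrec.list_getD 0).comp Primrec.fst (Primrec.const i))) Primrec.snd),
    fun p x hp a => ⟨?_, ?_⟩⟩
  · rintro n ⟨h1, h2⟩
    rw [length_pre] at h1
    rwa [getD_pre h1, hR p x hp] at h2
  · intro h
    filter_upwards [eventually_gt_atTop i] with n hn
    rw [length_pre, getD_pre hn, hR p x hp]
    exact ⟨hn, h⟩

end

/-! ### Tests for points of a tuple -/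

/-- A precision at which the first `K` coordinates of the first `K` points are available in
the prefix of length `n`, see `pair_precision_lt`. -/
def precision (K n : ℕ) : ℕ := n.sqrt.sqrt - K

/-- A pair of numbers below `t` is coded below `t ^ 2`, and a second pairing stays below `t ^ 4`;
this is at most `n` for `t = n.sqrt.sqrt`. -/
theorem pair_precision_lt {K n j l : ℕ} (hj : j ≤ K) (hl : l ≤ K)
    (hn : (K + 1) * (K + 1) * ((K + 1) * (K + 1)) ≤ n) :
    Nat.pair j (Nat.pair l (precision (K + 1) n)) < n := by
  set t := n.sqrt.sqrt with ht
  have h1 : t * t ≤ n.sqrt := Nat.sqrt_le _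
  have h2 : n.sqrt * n.sqrt ≤ n := Nat.sqrt_le _
  have h3 : K + 1 ≤ t := Nat.le_sqrt.2 (Nat.le_sqrt.2 hn)
  have h4 : Nat.pair l (precision (K + 1) n) < t * t := by
    refine (Nat.pair_lt_max_add_one_sq _ _).trans_le ?_
    rw [sq]
    have : max l (precision (K + 1) n) + 1 ≤ t := by
      rw [precision, ← ht]
      omega
    exact Nat.mul_le_mul this this
  refine (Nat.pair_lt_max_add_one_sq _ _).trans_le ?_
  rw [sq]
  have : max j (Nat.pair l (precision (K + 1) n)) + 1 ≤ t * t := by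
    have : t ≤ t * t := Nat.le_mul_self t
    omega
  exact (Nat.mul_le_mul (this.trans h1) (this.trans h1)).trans h2

theorem tendsto_precision (K : ℕ) : Tendsto (precision K) atTop atTop := by
  refine tendsto_atTop.2 fun b => ?_
  filter_upwards [eventually_ge_atTop ((b + K) * (b + K) * ((b + K) * (b + K)))] with n hn
  have : b + K ≤ n.sqrt.sqrt := Nat.le_sqrt.2 (Nat.le_sqrt.2 hn)
  rw [precision]
  omega

/-- The names of tuples of pairwise distinct points. -/
def distinctNames (d N : ℕ) (p : Name) (x : Fin N → Vec d) : Prop :=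
  x ∈ distinctTuples d N ∧ (rhoTuple d N).Names p x

variable {d N : ℕ} {σ : Type*} [Primcodable σ]

theorem approximable_coord (j : Fin N) (l : Fin d) :
    Approximable (distinctNames d N) fun x (_ : σ) => x j l := by
  have hprec : Primrec fun w : List ℕ => precision (d + N + 1) w.length :=
    Primrec.nat_sub.comp (Primrec.nat_sqrt.comp (Primrec.nat_sqrt.comp Primrec.list_length))
      (Primrec.const _)
  refine ⟨fun w _ => w.getD (Nat.pair j (Nat.pair l (precision (d + N + 1) w.length))) 0,
    fun w _ => halfPowCode (precision (d + N + 1) w.length),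
    ((Primrec.list_getD 0).comp Primrec.id (Primrec₂.natPair.comp (Primrec.const _)
      (Primrec₂.natPair.comp (Primrec.const _) hprec))).comp Primrec.fst,
    (primrec_halfPowCode.comp hprec).comp Primrec.fst,
    (d + N + 1) * (d + N + 1) * ((d + N + 1) * (d + N + 1)), fun p x hp a => ⟨fun n hn => ?_, ?_⟩⟩
  · beta_reduce
    rw [length_pre, getD_pre (pair_precision_lt (by omega) (by omega) hn), ratOf_halfPowCode]
    push_cast
    exact hp.2 j l _
  · simp only [length_pre, ratOf_halfPowCode]
    push_cast
    exact (tendsto_pow_atTop_nhds_zero_of_lt_one (by norm_num) (by norm_num)).comp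
      (tendsto_precision _)

/-- The code of the `l`-th entry of the list of rationals with code `c`. -/
def entryCode (c l : ℕ) : ℕ := (Denumerable.ofNat (List ℕ) c).getD l 0

theorem primrec_entryCode (l : ℕ) : Primrec fun c => entryCode c l :=
  (Primrec.list_getD 0).comp (Primrec.ofNat _) (Primrec.const l)

theorem exists_entryCode_eq (u : Fin d → ℚ) : ∃ c, ∀ l : Fin d, ratOf (entryCode c l) = u l := by
  choose c hc using fun i => ratOf_surjective (u i)
  exact ⟨Encodable.encode (List.ofFn c), fun l => by simp [entryCode, hc]⟩

/-- A search over codes of rational vectors, each tested by finitely many strict inequalities.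
Distinctness of the points is essential: it replaces `x i ≠ x j`, which a name does not decide, by
`i ≠ j`. -/
theorem semiDec_mem_extPts (hd : 1 ≤ d) (j : Fin N) :
    SemiDec (distinctNames d N) fun x (_ : σ) => x j ∈ extPts x := by
  have h : SemiDec (distinctNames d N) fun x (z : σ × ℕ) => ∀ i ∈ Finset.univ.erase j,
      0 < ∑ l : Fin d, (x j l - x i l) * (ratOf (entryCode z.2 l) : ℝ) :=
    SemiDec.forall_finset _ fun i _ => (Approximable.sum _ fun l =>
      ((approximable_coord j l).sub (approximable_coord i l)).mul
        (approximable_ratOf ((primrec_entryCode l).comp Primrec.snd))).semiDec_pos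
  refine h.exists_nat.congr fun p x hp _ => ?_
  have hx : Function.Injective x := hp.1
  simp only [sub_mul, Finset.sum_sub_distrib, sub_pos, Finset.mem_erase, Finset.mem_univ,
    and_true, mem_extPts_iff_exists_rat hd, hx.ne_iff]
  constructor
  · rintro ⟨c, hc⟩
    exact ⟨fun l => ratOf (entryCode c l), hc⟩
  · rintro ⟨u, hu⟩
    obtain ⟨c, hc⟩ := exists_entryCode_eq u
    exact ⟨c, by simpa only [hc] using hu⟩

/-- The code of the radius of the ball with code `k`. -/
def radiusCode (k : ℕ) : ℕ := k.unpair.2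

theorem primrec_radiusCode : Primrec radiusCode := Primrec.snd.comp Primrec.unpair

theorem approximable_radius : Approximable (distinctNames d N) fun _ k => (radius k : ℝ) :=
  approximable_ratOf primrec_radiusCode

theorem approximable_dist_sq (j : Fin N) :
    Approximable (distinctNames d N) fun x k => dist (x j) (center d k) ^ 2 := by
  have h : Approximable (distinctNames d N) fun x (k : ℕ) => ∑ l : Fin d,
      (x j l - (ratOf (entryCode k.unpair.1 l) : ℝ)) *
        (x j l - (ratOf (entryCode k.unpair.1 l) : ℝ)) := by
    refine Approximable.sum _ fun l => ?_
    have := (approximable_coord (d := d) (N := N) (σ := ℕ) j l).sub (approximable_ratOf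
      ((primrec_entryCode l).comp (Primrec.fst.comp Primrec.unpair)))
    exact this.mul this
  convert h using 3 with x k
  rw [EuclideanSpace.dist_eq, Real.sq_sqrt (by positivity)]
  refine Finset.sum_congr rfl fun l _ => ?_
  rw [Real.dist_eq, sq_abs, sq]
  rfl

/-- Squares are compared to avoid the root in the distance. The sign of the radius needs its own
test, since squaring forgets it. -/
theorem semiDec_mem_ball (j : Fin N) :
    SemiDec (distinctNames d N) fun x k => x j ∈ Metric.ball (center d k) (radius k) := by
  refine (approximable_radius.semiDec_pos.and ((approximable_radius.mul approximable_radius).sub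
    (approximable_dist_sq j)).semiDec_pos).congr fun p x _ k => ?_
  rw [Metric.mem_ball, sub_pos, ← sq]
  constructor
  · rintro ⟨h1, h2⟩
    exact lt_of_pow_lt_pow_left₀ 2 h1.le h2
  · intro h
    exact ⟨dist_nonneg.trans_lt h, pow_lt_pow_left₀ h dist_nonneg two_ne_zero⟩

theorem semiDec_notMem_closedBall (j : Fin N) :
    SemiDec (distinctNames d N) fun x k => x j ∉ Metric.closedBall (center d k) (radius k) := by
  refine (approximable_radius.neg.semiDec_pos.or ((approximable_dist_sq j).sub
    (approximable_radius.mul approximable_radius)).semiDec_pos).congr fun p x _ k => ?_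
  rw [Metric.mem_closedBall, not_le, sub_pos, ← sq, neg_pos]
  constructor
  · rintro (h | h)
    · exact h.trans_le dist_nonneg
    · exact lt_of_pow_lt_pow_left₀ 2 dist_nonneg h
  · intro h
    rcases lt_or_ge (radius k : ℝ) 0 with h0 | h0
    · exact Or.inl h0
    · exact Or.inr (pow_lt_pow_left₀ h h0 two_ne_zero)

/-! ### Machines -/

/-- The machine that, having read the prefix `w` of its input, appends `s w` to its output. -/
def stepMachine (s : List ℕ → List ℕ) (w : List ℕ) : List ℕ :=
  (List.range w.length).flatMap fun m => s (w.take m)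

/-- Step `m` sees only the first `m` symbols, so a longer input repeats the earlier steps unchanged
and then appends. -/
theorem isMachine_stepMachine {s : List ℕ → List ℕ} (hs : Primrec s) :
    IsMachine (stepMachine s) := by
  constructor
  · exact (Primrec.list_flatMap (Primrec.list_range.comp Primrec.list_length)
      (hs.comp (Primrec.list_take.comp Primrec.snd Primrec.fst)).to₂).to_comp
  · rintro u _ ⟨t, rfl⟩
    rw [stepMachine, stepMachine, List.length_append, List.range_add, List.flatMap_append]
    refine ⟨_, congrArg₂ _ ?_ rfl⟩
    rw [List.flatMap_def, List.flatMap_def]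
    congr 1
    refine List.map_congr_left fun m hm => ?_
    rw [List.take_append_of_le_length (List.mem_range.1 hm).le]

theorem stepMachine_pre (s : List ℕ → List ℕ) (p : Name) (n : ℕ) :
    stepMachine s (pre p n) = (List.range n).flatMap fun m => s (pre p m) := by
  rw [stepMachine, length_pre, List.flatMap_def, List.flatMap_def]
  congr 1
  exact List.map_congr_left fun m hm => by rw [take_pre (List.mem_range.1 hm).le]

section

variable {X σ : Type*} [Primcodable σ] {R : Name → X → Prop}

/-- Dovetailing: step `⟨k, i⟩` tests `k` on the prefix of length `i`, which has already been read
since `i ≤ ⟨k, i⟩`. A failed test writes the empty symbol `0`, so the output is always infinite. -/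
theorem SemiDec.exists_enumerator {U : X → ℕ → Prop} (hU : SemiDec R U) :
    ∃ h, IsMachine h ∧ ∀ p x, R p x → ∃ q, Outputs h p q ∧ enumerated q = {k | U x k} := by
  classical
  obtain ⟨T, hT, hU⟩ := hU
  let v : List ℕ → ℕ := fun w =>
    if T (w.take w.length.unpair.2) w.length.unpair.1 then w.length.unpair.1 + 1 else 0
  have hunpair : Primrec fun w : List ℕ => w.length.unpair :=
    Primrec.unpair.comp Primrec.list_length
  have hv : Primrec v := Primrec.ite
    (hT.comp (Primrec.list_take.comp (Primrec.snd.comp hunpair) Primrec.id)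
      (Primrec.fst.comp hunpair))
    (Primrec.succ.comp (Primrec.fst.comp hunpair)) (Primrec.const 0)
  refine ⟨stepMachine fun w => [v w],
    isMachine_stepMachine (Primrec.list_cons.comp hv (Primrec.const [])), fun p x hp =>
    ⟨fun n => v (pre p n), fun n => ⟨n, ?_⟩, ?_⟩⟩
  · rw [stepMachine_pre, ← List.map_eq_flatMap, pre]
  · ext k
    have hvn : ∀ n, v (pre p n) = if T (pre p n.unpair.2) n.unpair.1 then n.unpair.1 + 1 else 0 :=
      fun n => by simp only [v, length_pre, take_pre (Nat.unpair_right_le n)]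
    constructor
    · rintro ⟨n, hn⟩
      simp only [hvn] at hn
      split_ifs at hn with h
      have hk : n.unpair.1 = k := by omega
      exact (hU p x hp k).1 _ (hk ▸ h)
    · intro hk
      obtain ⟨n, hn⟩ := ((hU p x hp k).2 hk).exists
      exact ⟨Nat.pair k n, by simp only [hvn, Nat.unpair_pair, if_pos hn]⟩

/-- The same dovetailing, writing a candidate only after it passes. Every symbol written is then `f
x`, and since passing tests persist, infinitely many are written, as an infinite name requires. -/
theorem SemiDec.exists_search {f : X → ℕ} (hU : SemiDec R fun x c => c = f x) :
    ∃ h, IsMachine h ∧ ∀ p x, R p x → Outputs h p fun _ => f x := by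
  classical
  obtain ⟨T, hT, hU⟩ := hU
  let s : List ℕ → List ℕ := fun w =>
    if T (w.take w.length.unpair.2) w.length.unpair.1 then [w.length.unpair.1] else []
  have hunpair : Primrec fun w : List ℕ => w.length.unpair :=
    Primrec.unpair.comp Primrec.list_length
  have hs : Primrec s := Primrec.ite
    (hT.comp (Primrec.list_take.comp (Primrec.snd.comp hunpair) Primrec.id)
      (Primrec.fst.comp hunpair))
    (Primrec.list_cons.comp (Primrec.fst.comp hunpair) (Primrec.const [])) (Primrec.const [])
  refine ⟨stepMachine s, isMachine_stepMachine hs, fun p x hp => ?_⟩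
  have hsn : ∀ n, s (pre p n) = if T (pre p n.unpair.2) n.unpair.1 then [n.unpair.1] else [] :=
    fun n => by simp only [s, length_pre, take_pre (Nat.unpair_right_le n)]
  have hrep : ∀ n, stepMachine s (pre p n) =
      List.replicate (stepMachine s (pre p n)).length (f x) := by
    intro n
    refine List.eq_replicate_of_mem fun c hc => ?_
    rw [stepMachine_pre, List.mem_flatMap] at hc
    obtain ⟨m, -, hm⟩ := hc
    rw [hsn] at hm
    split_ifs at hm with h
    · rw [List.mem_singleton.1 hm]
      exact (hU p x hp _).1 _ h
    · simp at hm
  have hlen : ∀ n, ∃ k, n ≤ (stepMachine s (pre p k)).length := by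
    intro n
    induction n with
    | zero => exact ⟨0, Nat.zero_le _⟩
    | succ n ih =>
      obtain ⟨k, hk⟩ := ih
      obtain ⟨i, hi, hT⟩ := ((eventually_ge_atTop k).and ((hU p x hp (f x)).2 rfl)).exists
      have hle : k ≤ Nat.pair (f x) i := hi.trans (Nat.right_le_pair _ _)
      refine ⟨Nat.pair (f x) i + 1, ?_⟩
      have hmono : (stepMachine s (pre p k)).length ≤
          (stepMachine s (pre p (Nat.pair (f x) i))).length := by
        refine ((isMachine_stepMachine hs).2 _ _ ?_).length_le
        rw [← take_pre hle]
        exact List.take_prefix _ _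
      rw [stepMachine_pre, List.range_succ, List.flatMap_append, List.length_append,
        ← stepMachine_pre, List.flatMap_singleton, hsn, Nat.unpair_pair, if_pos hT]
      exact Nat.succ_le_succ (hk.trans hmono)
  intro n
  obtain ⟨k, hk⟩ := hlen n
  refine ⟨k, ?_⟩
  rw [hrep k]
  exact ⟨List.replicate ((stepMachine s (pre p k)).length - n) (f x), by
    rw [pre, List.map_const', List.length_range, List.replicate_append_replicate,
      Nat.add_sub_cancel' hk]⟩

theorem SemiDec.exists_decider {U : X → Prop} (hU : SemiDec R fun x (_ : Unit) => U x) :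
    ∃ h : List ℕ → Bool, Computable h ∧
      ∀ p x, R p x → (U x ↔ ∃ n, h (pre p n) = true) := by
  classical
  obtain ⟨T, hT, hU⟩ := hU
  refine ⟨fun w => decide (T w ()),
    (PrimrecPred.decide (hT.comp Primrec.id (Primrec.const ()))).to_comp, fun p x hp => ?_⟩
  simp only [decide_eq_true_eq]
  exact ⟨fun h => ((hU p x hp ()).2 h).exists, fun ⟨n, h⟩ => (hU p x hp ()).1 n h⟩

end

/-! ### Computing the set of extreme points -/

variable {d N : ℕ}

theorem mem_nu_fin {N c : ℕ} {j : Fin N}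
    (h : j ∈ ((Encodable.decode c : Option (Fin N)) : Part (Fin N))) : c = j := by
  rw [Part.mem_ofOption, Option.mem_def] at h
  rw [show Fin.encodable N = Encodable.ofEquiv { m // m < N } Fin.equivSubtype from rfl,
    Encodable.decode_ofEquiv, Option.map_eq_some_iff] at h
  obtain ⟨a, ha, rfl⟩ := h
  change Encodable.decodeSubtype c = some a at ha
  unfold Encodable.decodeSubtype at ha
  simp only [Encodable.decode_nat, Option.bind_some] at ha
  split_ifs at ha
  obtain rfl := Option.some.inj ha
  rfl

theorem semiDecidableOn_mem_extPts (hd : 1 ≤ d) :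
    SemiDecidableOn ((rhoTuple d N).prod (nu (Fin N))) {z | z.1 z.2 ∈ extPts z.1}
      {z | z.1 ∈ distinctTuples d N} := by
  let R : Name → (Fin N → Vec d) × Fin N → Prop := fun p z =>
    z.1 ∈ distinctTuples d N ∧ ((rhoTuple d N).prod (nu (Fin N))).Names p z
  -- The index is itself input: it is the first symbol of the second component, hence sits at
  -- position `1` of the interleaved name, and is compared with each of the finitely many `j`.
  have h : SemiDec R fun z (_ : Unit) => ∃ j ∈ (Finset.univ : Finset (Fin N)),
      (z.2 : ℕ) = j ∧ z.1 j ∈ extPts z.1 :=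
    SemiDec.exists_finset _ fun j => (semiDec_symbol (V := fun c _ => c = (j : ℕ))
      (Primrec.eq.comp Primrec.fst (Primrec.const _)) 1 Primrec.id
      fun p z hp => mem_nu_fin hp.2.2).and
      ((semiDec_mem_extPts hd j).evens.map Prod.fst fun p z hp => ⟨hp.1, hp.2.1⟩)
  obtain ⟨h, hh, H⟩ := (h.congr (V := fun z _ => z.1 z.2 ∈ extPts z.1) fun p z _ _ =>
    ⟨fun ⟨j, _, hj, hm⟩ => Fin.ext hj ▸ hm,
      fun hm => ⟨z.2, Finset.mem_univ _, rfl, hm⟩⟩).exists_decider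
  exact ⟨h, hh, fun p z hz hp => H p z ⟨hz, hp⟩⟩

theorem computableOn_extchull_psiLower (hd : 1 ≤ d) :
    ComputableOn (rhoTuple d N) (psiLower d) (extchull d N) (distinctTuples d N) := by
  have h : SemiDec (distinctNames d N) fun x k => ∃ j ∈ Finset.univ,
      x j ∈ extPts x ∧ x j ∈ Metric.ball (center d k) (radius k) :=
    SemiDec.exists_finset _ fun j => (semiDec_mem_extPts hd j).and (semiDec_mem_ball j)
  obtain ⟨h, hh, H⟩ := h.exists_enumerator
  refine ⟨h, hh, fun p x hx hp => ?_⟩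
  obtain ⟨q, hq, hqe⟩ := H p x ⟨hx, hp⟩
  refine ⟨q, hq, hqe.trans ?_⟩
  ext k
  constructor
  · rintro ⟨j, -, h1, h2⟩
    exact ⟨x j, h2, h1⟩
  · rintro ⟨y, h2, h1⟩
    obtain ⟨j, rfl⟩ := extPts_subset x h1
    exact ⟨j, Finset.mem_univ _, h1, h2⟩

/-- Names of tuples of distinct points, interleaved with a name whose first symbol determines
the number of extreme points by means of `t`. -/
def cardNames (d N : ℕ) (t : ℕ → ℕ) (p : Name) (x : Fin N → Vec d) : Prop :=
  distinctNames d N (fun n => p (2 * n)) x ∧ t (p 1) = (extPts x).ncard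

/-- Once as many indices are confirmed as there are extreme points, none is missing; the cardinality
turns positive information into full information. -/
theorem semiDec_extIndices_eq {σ : Type*} [Primcodable σ] (hd : 1 ≤ d) {t : ℕ → ℕ}
    (ht : Primrec t) (S : Finset (Fin N)) :
    SemiDec (cardNames d N t) fun x (_ : σ) => extIndices x = S := by
  refine ((semiDec_symbol (V := fun c _ => c = S.card)
    (Primrec.eq.comp Primrec.fst (Primrec.const _)) 1 ht fun p x hp => hp.2).and
    (SemiDec.forall_finset S fun j _ => (semiDec_mem_extPts hd j).evens.map id
      fun p x hp => hp.1)).congr fun p x hp a => ?_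
  have hcard := card_extIndices (x := x) hp.1.1
  constructor
  · rintro ⟨h1, h2⟩
    exact (Finset.eq_of_subset_of_card_le (fun j hj => mem_extIndices.2 (h2 j hj))
      (hcard.trans h1).le).symm
  · rintro rfl
    exact ⟨hcard.symm, fun j hj => mem_extIndices.1 hj⟩

theorem exists_extIndices_machine (hd : 1 ≤ d) {t : ℕ → ℕ} (ht : Primrec t) :
    ∃ h, IsMachine h ∧ ∀ p (x : Fin N → Vec d), cardNames d N t p x →
      Outputs h p fun _ => Encodable.encode (extIndices x) := by
  have h : SemiDec (cardNames d N t) fun x c => ∃ S ∈ Finset.univ,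
      extIndices x = S ∧ c = Encodable.encode S :=
    SemiDec.exists_finset _ fun S => (semiDec_extIndices_eq hd ht S).and
      (semiDec_of_primrecPred (Primrec.eq.comp Primrec.id (Primrec.const _)))
  refine (h.congr fun p x _ c => ⟨?_, ?_⟩).exists_search
  · rintro ⟨S, -, rfl, h⟩
    exact h
  · exact fun h => ⟨_, Finset.mem_univ _, rfl, h⟩

theorem exists_extchull_machine (hd : 1 ≤ d) {t : ℕ → ℕ} (ht : Primrec t) :
    ∃ h, IsMachine h ∧ ∀ p (x : Fin N → Vec d), cardNames d N t p x →
      ∃ q, Outputs h p q ∧ (psiUpper d).Names q (extchull d N x) := by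
  have h : SemiDec (cardNames d N t) fun x k => ∃ S ∈ Finset.univ,
      extIndices x = S ∧ ∀ j ∈ S, x j ∉ Metric.closedBall (center d k) (radius k) :=
    SemiDec.exists_finset _ fun S => (semiDec_extIndices_eq hd ht S).and
      (SemiDec.forall_finset S fun j _ => (semiDec_notMem_closedBall j).evens.map id
        fun p x hp => hp.1)
  obtain ⟨h, hh, H⟩ := h.exists_enumerator
  refine ⟨h, hh, fun p x hp => ?_⟩
  obtain ⟨q, hq, hqe⟩ := H p x hp
  refine ⟨q, hq, hqe.trans ?_⟩
  ext k
  change (∃ S ∈ Finset.univ, extIndices x = S ∧ _) ↔ Disjoint _ (extPts x)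
  rw [extPts_eq_image, Set.disjoint_right]
  constructor
  · rintro ⟨S, -, rfl, h⟩ _ ⟨j, hj, rfl⟩
    exact h j hj
  · exact fun h => ⟨_, Finset.mem_univ _, rfl, fun j hj => h ⟨j, hj, rfl⟩⟩

/-! ### Computability from the number of extreme points and from advice -/

theorem cardNames_of_prod_nu {p : Name} {z : (Fin N → Vec d) × ℕ}
    (hz : z.1 ∈ distinctTuples d N ∧ z.2 = (extPts z.1).ncard)
    (hp : ((rhoTuple d N).prod (nu ℕ)).Names p z) : cardNames d N id p z.1 := by
  refine ⟨⟨hz.1, hp.1⟩, ?_⟩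
  have h : z.2 ∈ ((Encodable.decode (p 1) : Option ℕ) : Part ℕ) := hp.2
  rw [← hz.2]
  simpa using (Part.mem_ofOption.1 h)

theorem computableOn_extIndices (hd : 1 ≤ d) :
    ComputableOn ((rhoTuple d N).prod (nu ℕ)) (nu (Finset (Fin N))) (fun z => extIndices z.1)
      {z | z.1 ∈ distinctTuples d N ∧ z.2 = (extPts z.1).ncard} := by
  obtain ⟨h, hh, H⟩ := exists_extIndices_machine (N := N) hd Primrec.id
  refine ⟨h, hh, fun p z hz hp => ⟨_, H p z.1 (cardNames_of_prod_nu hz hp), ?_⟩⟩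
  change _ ∈ ((Encodable.decode _ : Option (Finset (Fin N))) : Part (Finset (Fin N)))
  simp

theorem computableOn_extchull_psiUpper (hd : 1 ≤ d) :
    ComputableOn ((rhoTuple d N).prod (nu ℕ)) (psiUpper d) (fun z => extchull d N z.1)
      {z | z.1 ∈ distinctTuples d N ∧ z.2 = (extPts z.1).ncard} := by
  obtain ⟨h, hh, H⟩ := exists_extchull_machine (N := N) hd Primrec.id
  exact ⟨h, hh, fun p z hz hp => H p z.1 (cardNames_of_prod_nu hz hp)⟩

/-- The parts are the fibres of `label`, each denoted by its value. The label only has to determine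
the number of extreme points through `t`; it may be finer, which the case of dimension one uses. -/
theorem computableWithAdvice_of_label (hd : 1 ≤ d) {K : ℕ} (label : (Fin N → Vec d) → ℕ)
    {t : ℕ → ℕ} (ht : Primrec t)
    (hlabel : ∀ x ∈ distinctTuples d N, label x < K ∧ t (label x) = (extPts x).ncard)
    (hsurj : ∀ c < K, ∃ x ∈ distinctTuples d N, label x = c) :
    ComputableWithAdvice (rhoTuple d N) (psiUpper d) (extchull d N) (distinctTuples d N) K := by
  let part : ℕ → Set (Fin N → Vec d) := fun c => {x | x ∈ distinctTuples d N ∧ label x = c}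
  refine ⟨part '' Set.Iio K, ⟨?_, ?_, ?_⟩, ?_, fun c => ⟨c < K, fun h => ⟨part c, c, h, rfl⟩⟩,
    ?_, ?_⟩
  · rintro ⟨c, hc, he⟩
    obtain ⟨x, hx⟩ := hsurj c hc
    exact (he ▸ hx : x ∈ (∅ : Set (Fin N → Vec d)))
  · rintro _ ⟨c, -, rfl⟩ _ ⟨c', -, rfl⟩ hne
    refine Set.disjoint_left.2 fun x hx hx' => hne ?_
    rw [← hx.2, ← hx'.2]
  · ext x
    constructor
    · rintro ⟨_, ⟨c, -, rfl⟩, hx⟩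
      exact hx.1
    · exact fun hx => ⟨_, ⟨label x, (hlabel x hx).1, rfl⟩, hx, rfl⟩
  · rw [Set.InjOn.encard_image]
    · simp [Set.encard_coe_eq_coe_finsetCard, ← Finset.coe_Iio]
    · intro c hc c' _ he
      obtain ⟨x, hx⟩ := hsurj c hc
      have hx' : x ∈ part c' := he ▸ hx
      exact hx.2.symm.trans hx'.2
  · rintro ⟨_, c, hc, rfl⟩
    exact ⟨c, hc, rfl⟩
  · obtain ⟨h, hh, H⟩ := exists_extchull_machine (N := N) hd ht
    refine ⟨h, hh, fun p z hz hp => H p z.1 ?_⟩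
    obtain ⟨hc, he⟩ := hp.2
    have hx : z.1 ∈ part (p 1) := by
      have : part (p 1) = z.2.1 := congrArg Subtype.val he
      rw [this]
      exact hz
    refine ⟨⟨hx.1, hp.1⟩, ?_⟩
    rw [← (hlabel z.1 hx.1).2, hx.2]

theorem computableWithAdvice_extchull (hd : 1 ≤ d) (hN : 2 ≤ N) :
    ComputableWithAdvice (rhoTuple d N) (psiUpper d) (extchull d N) (distinctTuples d N)
      (N - 1) := by
  rcases hd.eq_or_lt with rfl | hd2
  -- In dimension one the number of extreme points is always `2`, yet exactly `N - 1` nonempty parts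
  -- are required. Any label with values `0, …, N - 2` will do, here a truncated floor of the first
  -- point.
  · refine computableWithAdvice_of_label le_rfl (fun x => min ⌊x ⟨0, by omega⟩ 0⌋₊ (N - 2))
      (Primrec.const 2) (fun x hx => ⟨by omega, (ncard_extPts_of_one_dim hN hx).symm⟩)
      fun c hc => ⟨fun i => WithLp.toLp 2 fun _ => (c : ℝ) + (i : ℕ), fun i j hij => ?_, ?_⟩
    · have := congrFun (congrArg WithLp.ofLp hij) 0
      simp only [add_right_inj] at this
      exact Fin.ext (by exact_mod_cast this)
    · simp only [CharP.cast_eq_zero, add_zero, Nat.floor_natCast]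
      omega
  · refine computableWithAdvice_of_label hd (fun x => (extPts x).ncard - 2)
      (t := fun c => c + 2) (Primrec.nat_add.comp Primrec.id (Primrec.const 2))
      (fun x hx => ?_) fun c hc => ?_
    · have h1 := two_le_ncard_extPts hN hx
      have h2 := ncard_extPts_le hx
      omega
    · refine ⟨kinked d N fun l => if 1 ≤ (l : ℕ) ∧ (l : ℕ) ≤ c then 1 else 0,
        kinked_injective hd2 _, ?_⟩
      rw [ncard_extPts_kinked (m := c) hd2 (by omega)]
      · rfl
      · intro l
        split_ifs <;> norm_num
      · intro l
        split_ifs with h <;> simp [h]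

/-! ### Discontinuity -/

/-- `x` has a name all of whose prefixes are prefixes of names of all points near `x`. -/
theorem exists_open_name {d N : ℕ} (x : Fin N → Vec d) :
    ∃ p, (rhoTuple d N).Names p x ∧
      ∀ L, ∀ᶠ z in 𝓝 x, ∃ p', (rhoTuple d N).Names p' z ∧ ∀ i < L, p' i = p i := by
  obtain ⟨p₀, hp₀⟩ := (rhoTuple d N).surj x
  -- Each entry is taken one step more precise than required; the slack `(1 / 2) ^ (n + 1)` lets the
  -- same entry serve nearby points.
  let p : Name := fun m => p₀ (Nat.pair m.unpair.1
    (Nat.pair m.unpair.2.unpair.1 (m.unpair.2.unpair.2 + 1)))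
  have hp : ∀ (j : Fin N) (l : Fin d) n,
      |x j l - (ratOf (p (Nat.pair j (Nat.pair l n))) : ℝ)| ≤ (1 / 2) ^ (n + 1) := by
    intro j l n
    simp only [p, Nat.unpair_pair]
    exact hp₀ j l (n + 1)
  refine ⟨p, fun j l n => (hp j l n).trans
    (pow_le_pow_of_le_one (by norm_num) (by norm_num) n.le_succ), fun L => ?_⟩
  have hclose : ∀ᶠ z in 𝓝 x, ∀ (j : Fin N) (l : Fin d), |z j l - x j l| < (1 / 2) ^ (L + 1) := by
    refine eventually_all.2 fun j => eventually_all.2 fun l => ?_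
    have hc : Continuous fun z : Fin N → Vec d => |z j l - x j l| := by fun_prop
    refine (hc.tendsto x).eventually_lt_const ?_
    simp
  filter_upwards [hclose] with z hz
  obtain ⟨z₀, hz₀⟩ := (rhoTuple d N).surj z
  refine ⟨fun m => if m < L then p m else z₀ m, fun j l n => ?_, fun i hi => if_pos hi⟩
  beta_reduce
  split_ifs with h
  -- A position `⟨j, ⟨l, n⟩⟩` is at least `n`, so below `L` the slack is at least the distance bound
  -- `(1 / 2) ^ (L + 1)`.
  · have hn : n + 1 ≤ L + 1 := by
      have h1 := Nat.right_le_pair (j : ℕ) (Nat.pair l n)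
      have h2 := Nat.right_le_pair (l : ℕ) n
      omega
    have h1 := abs_lt.1 (hz j l)
    have h2 := abs_le.1 (hp j l n)
    have h3 : (1 / 2 : ℝ) ^ (L + 1) ≤ (1 / 2) ^ (n + 1) :=
      pow_le_pow_of_le_one (by norm_num) (by norm_num) hn
    have h4 : (1 / 2 : ℝ) ^ n = 2 * (1 / 2) ^ (n + 1) := by ring
    rw [h4, abs_le]
    constructor <;> linarith
  · exact hz₀ j l n

theorem exists_prefix_of_continuousOn {F : Name → Name} {S : Set Name} (hF : ContinuousOn F S)
    {p : Name} (hp : p ∈ S) (n : ℕ) :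
    ∃ L, ∀ p' ∈ S, (∀ i < L, p' i = p i) → F p' n = F p n := by
  have h : Tendsto (fun q => F q n) (𝓝[S] p) (𝓝 (F p n)) :=
    ((continuous_apply n).tendsto _).comp (hF p hp)
  rw [nhds_discrete, tendsto_pure] at h
  obtain ⟨u, hu, hpu, hsub⟩ := mem_nhdsWithin.1 h
  obtain ⟨I, v, hv, hvu⟩ := isOpen_pi_iff.1 hu p hpu
  refine ⟨I.sup id + 1, fun p' hp' hpp => hsub ⟨hvu fun i hi => ?_, hp'⟩⟩
  rw [hpp i (Nat.lt_succ_of_le (Finset.le_sup (f := id) hi))]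
  exact (hv i hi).2

/-- If `x j` is not extreme, the realizer lists a ball around `x j` after finitely many symbols of
an open name. Nearby `z ∈ D` have names with these same symbols, so the ball is listed for `z` too;
it contains `z j`, which therefore is not extreme. -/
theorem eventually_extIndices_subset {d N : ℕ} {D : Set (Fin N → Vec d)}
    (hF : ContinuousRealizable (rhoTuple d N) (psiUpper d) (extchull d N) D)
    {x : Fin N → Vec d} (hx : x ∈ D) :
    ∀ᶠ z in 𝓝 x, z ∈ D → extIndices z ⊆ extIndices x := by
  obtain ⟨F, hF, hFn⟩ := hF
  obtain ⟨p, hp, hopen⟩ := exists_open_name x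
  have key : ∀ j, ∀ᶠ z in 𝓝 x, z ∈ D → j ∈ extIndices z → j ∈ extIndices x := by
    intro j
    by_cases hj : j ∈ extIndices x
    · exact Eventually.of_forall fun _ _ _ => hj
    have hjx : x j ∉ (extchull d N x : Set (Vec d)) := fun h => hj (mem_extIndices.2 h)
    obtain ⟨ε, hε, hball⟩ := Metric.isOpen_iff.1 (extchull d N x).isClosed.isOpen_compl (x j) hjx
    obtain ⟨k, hk1, hk2⟩ := exists_small_ball (x j) hε
    have hk : k ∈ enumerated (F p) := by
      rw [show enumerated (F p) = _ from hFn p x hx hp]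
      exact Set.disjoint_left.2 fun y hy => hball (hk2 hy)
    obtain ⟨n, hn⟩ := hk
    obtain ⟨L, hL⟩ := exists_prefix_of_continuousOn hF ⟨x, hx, hp⟩ n
    have hev : ∀ᶠ z : Fin N → Vec d in 𝓝 x, z j ∈ Metric.ball (center d k) (radius k) :=
      ((continuous_apply j).tendsto x).eventually (Metric.isOpen_ball.mem_nhds hk1)
    filter_upwards [hopen L, hev] with z hz hzk hzD hjz
    obtain ⟨p', hp', hpp⟩ := hz
    have hkz : k ∈ enumerated (F p') := ⟨n, (hL p' ⟨z, hzD, hp'⟩ hpp).trans hn⟩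
    rw [show enumerated (F p') = _ from hFn p' z hzD hp'] at hkz
    exact absurd (mem_extIndices.1 hjz)
      (Set.disjoint_left.1 hkz (Metric.ball_subset_closedBall hzk))
  filter_upwards [eventually_all.2 key] with z hz hzD j hj
  exact hz j hzD hj

/-- If every point of level `m < K` is a limit of points of level `m + 1`, and if points of
higher levels near a point never share its colour, then there are more than `K` colours. -/
theorem exists_colours_of_levels {X C : Type*} [TopologicalSpace X] {K : ℕ} (level : ℕ → Set X)
    (colour : X → C) (h0 : (level 0).Nonempty)
    (hsucc : ∀ m < K, ∀ x ∈ level m, ∃ᶠ y in 𝓝 x, y ∈ level (m + 1))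
    (hcolour : ∀ m ≤ K, ∀ x ∈ level m, ∀ᶠ y in 𝓝 x, ∀ m' ≤ K, m < m' → y ∈ level m' →
      colour y ≠ colour x) :
    ∃ T : Finset C, T.card = K + 1 ∧ ∀ c ∈ T, ∃ m ≤ K, ∃ x ∈ level m, colour x = c := by
  classical
  -- The invariant: `m` colours are already used, and near `x` no point of level at least `m` has
  -- any of them. It applies to `x` itself, so the colour of `x` is new; it survives the next step
  -- because the next point is chosen inside that neighbourhood.
  have key : ∀ m ≤ K, ∃ x ∈ level m, ∃ T : Finset C, T.card = m ∧
      (∀ c ∈ T, ∃ m ≤ K, ∃ x ∈ level m, colour x = c) ∧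
      ∀ᶠ y in 𝓝 x, ∀ m' ≤ K, m ≤ m' → y ∈ level m' → colour y ∉ T := by
    intro m
    induction m with
    | zero =>
      intro _
      obtain ⟨x, hx⟩ := h0
      exact ⟨x, hx, ∅, rfl, by simp, by simp⟩
    | succ m ih =>
      intro hm
      obtain ⟨x, hx, T, hT, hTc, hev⟩ := ih (by omega)
      have hxT : colour x ∉ T := hev.self_of_nhds m (by omega) le_rfl hx
      have hev' : ∀ᶠ y in 𝓝 x, ∀ m' ≤ K, m + 1 ≤ m' → y ∈ level m' →
          colour y ∉ insert (colour x) T := by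
        filter_upwards [hev, hcolour m (by omega) x hx] with y h1 h2 m' hm'K hm' hy
        rw [Finset.mem_insert, not_or]
        exact ⟨h2 m' hm'K hm' hy, h1 m' hm'K (by omega) hy⟩
      obtain ⟨y, hy, hyev⟩ :=
        ((hsucc m (by omega) x hx).and_eventually (eventually_eventually_nhds.2 hev')).exists
      refine ⟨y, hy, insert (colour x) T, by rw [Finset.card_insert_of_notMem hxT, hT], ?_, hyev⟩
      intro c hc
      rcases Finset.mem_insert.1 hc with rfl | hc
      exacts [⟨m, by omega, x, hx, rfl⟩, hTc c hc]
  obtain ⟨x, hx, T, hT, hTc, hev⟩ := key K le_rfl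
  have hxT : colour x ∉ T := hev.self_of_nhds K le_rfl le_rfl hx
  refine ⟨insert (colour x) T, by rw [Finset.card_insert_of_notMem hxT, hT], fun c hc => ?_⟩
  rcases Finset.mem_insert.1 hc with rfl | hc
  exacts [⟨K, le_rfl, x, hx, rfl⟩, hTc c hc]

/-- The tuples `kinked d N ε` for which exactly `ε₁, …, εₘ` are positive. -/
def kinkedLevel (d N m : ℕ) : Set (Fin N → Vec d) :=
  {x | ∃ ε : Fin N → ℝ, (∀ l, 0 ≤ ε l) ∧ (∀ l, 0 < ε l ↔ 1 ≤ (l : ℕ) ∧ (l : ℕ) ≤ m) ∧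
    kinked d N ε = x}

/-- The kink at `m + 1` is switched on with a strength `t > 0` that tends to `0`. -/
theorem kinkedLevel_frequently_succ {d N m : ℕ} (hm : m + 2 < N) {x : Fin N → Vec d}
    (hx : x ∈ kinkedLevel d N m) : ∃ᶠ y in 𝓝 x, y ∈ kinkedLevel d N (m + 1) := by
  obtain ⟨ε, h0, hpos, rfl⟩ := hx
  let i : Fin N := ⟨m + 1, by omega⟩
  have hzero : ε i = 0 := by
    refine le_antisymm (not_lt.1 fun h => ?_) (h0 i)
    have := (hpos i).1 h
    simp only [i] at this
    omega
  have hc : Continuous fun t : ℝ => kinked d N (Function.update ε i t) :=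
    (continuous_kinked d N).comp (continuous_const.update i continuous_id)
  have ht : Tendsto (fun t : ℝ => kinked d N (Function.update ε i t)) (𝓝[>] 0)
      (𝓝 (kinked d N ε)) := by
    have := hc.tendsto 0
    rw [← hzero, Function.update_eq_self, hzero] at this
    exact this.mono_left nhdsWithin_le_nhds
  refine ht.frequently (Eventually.frequently ?_)
  filter_upwards [self_mem_nhdsWithin] with t htpos
  have htpos : 0 < t := htpos
  refine ⟨_, fun l => ?_, fun l => ?_, rfl⟩ <;> rcases eq_or_ne l i with rfl | hl
  · simpa using htpos.le
  · simpa [hl] using h0 l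
  · simpa [i] using htpos
  · have : (l : ℕ) ≠ m + 1 := fun h => hl (Fin.ext h)
    rw [Function.update_of_ne hl, hpos]
    omega

theorem kinkedLevel_subset {d N m : ℕ} (hd : 2 ≤ d) : kinkedLevel d N m ⊆ distinctTuples d N := by
  rintro _ ⟨ε, -, -, rfl⟩
  exact kinked_injective hd ε

theorem card_extIndices_kinkedLevel {d N m : ℕ} (hd : 2 ≤ d) (hm : m + 2 ≤ N)
    {x : Fin N → Vec d} (hx : x ∈ kinkedLevel d N m) : (extIndices x).card = m + 2 := by
  rw [card_extIndices (kinkedLevel_subset hd hx)]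
  obtain ⟨ε, h0, hpos, rfl⟩ := hx
  exact ncard_extPts_kinked hd hm h0 hpos

/-- Tuples are coloured by their parts. A nearby tuple of higher level in the same part would have
its extreme indices among those of `x`, but it has more of them. So the levels `0, …, N - 2` require
`N - 1` parts. -/
theorem not_kWiseContinuous_extchull {d N k : ℕ} (hd : 2 ≤ d) (hN : 2 ≤ N) (hk : k ≤ N - 2) :
    ¬ KWiseContinuous (rhoTuple d N) (psiUpper d) (extchull d N) (distinctTuples d N) k := by
  rintro ⟨Δ, ⟨-, -, hcover⟩, hcard, hcont⟩
  have hex : ∀ x : Fin N → Vec d, ∃ D, x ∈ distinctTuples d N → D ∈ Δ ∧ x ∈ D := by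
    intro x
    by_cases hx : x ∈ distinctTuples d N
    · obtain ⟨D, hD, hxD⟩ := (hcover ▸ hx : x ∈ ⋃₀ Δ)
      exact ⟨D, fun _ => ⟨hD, hxD⟩⟩
    -- A dummy colour outside the domain, never used because all levels consist of tuples of
    -- distinct points.
    · exact ⟨∅, fun h => absurd h hx⟩
  choose colour hcol using hex
  obtain ⟨T, hT, hTc⟩ := exists_colours_of_levels (K := N - 2) (kinkedLevel d N) colour
    ⟨_, fun _ => 0, fun _ => le_rfl, fun l => by simp; omega, rfl⟩
    (fun m hm x hx => kinkedLevel_frequently_succ (by omega) hx) fun m hm x hx => by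
      obtain ⟨hD, hxD⟩ := hcol x (kinkedLevel_subset hd hx)
      filter_upwards [eventually_extIndices_subset (hcont _ hD) hxD] with y hy m' hm' hlt hym'
      intro heq
      have hyD := (hcol y (kinkedLevel_subset hd hym')).2
      have hle := Finset.card_le_card (hy (heq ▸ hyD))
      rw [card_extIndices_kinkedLevel hd (by omega) hym',
        card_extIndices_kinkedLevel hd (by omega) hx] at hle
      omega
  have hsub : (T : Set (Set (Fin N → Vec d))) ⊆ Δ := by
    intro c hc
    obtain ⟨m, -, x, hx, rfl⟩ := hTc c hc
    exact (hcol x (kinkedLevel_subset hd hx)).1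
  have hle := Set.encard_le_encard hsub
  rw [hcard, Set.encard_coe_eq_coe_finsetCard, hT] at hle
  have : N - 2 + 1 ≤ k := by exact_mod_cast hle
  omega

end TTE

theorem proposition2p7 (d N : ℕ) (hd : 1 ≤ d) :
    -- (a) extreme points are cut off by halfspaces with rational normal vector
    (∀ x ∈ TTE.distinctTuples d N, ∀ y ∈ TTE.extPts x,
      ∃ (u : Fin d → ℚ) (t : ℝ), u ≠ 0 ∧
        TTE.halfspace (fun i => (u i : ℝ)) t ∩ Set.range x = {y} ∧ ∃ j, y = x j) ∧
    -- (b) the converse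
    (∀ x ∈ TTE.distinctTuples d N, ∀ (u : Fin d → ℝ) (t : ℝ) (j : Fin N), u ≠ 0 →
      TTE.halfspace u t ∩ Set.range x = {x j} → x j ∈ TTE.extPts x) ∧
    -- (c) semi-decidability of extremality
    TTE.SemiDecidableOn ((TTE.rhoTuple d N).prod (TTE.nu (Fin N)))
      {z | z.1 z.2 ∈ TTE.extPts z.1} {z | z.1 ∈ TTE.distinctTuples d N} ∧
    -- (d) positive information on the set of extreme points
    TTE.ComputableOn (TTE.rhoTuple d N) (TTE.psiLower d) (TTE.extchull d N)
      (TTE.distinctTuples d N) ∧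
    -- (e) computability given the number of extreme points
    (2 ≤ N →
      (∀ x ∈ TTE.distinctTuples d N,
        2 ≤ (TTE.extPts x).ncard ∧ (TTE.extPts x).ncard ≤ N ∧
        (TTE.extIndices x).card = (TTE.extPts x).ncard ∧
        TTE.extPts x = x '' (TTE.extIndices x : Set (Fin N))) ∧
      TTE.ComputableOn ((TTE.rhoTuple d N).prod (TTE.nu ℕ)) (TTE.nu (Finset (Fin N)))
        (fun z => TTE.extIndices z.1)
        {z | z.1 ∈ TTE.distinctTuples d N ∧ z.2 = (TTE.extPts z.1).ncard} ∧
      TTE.ComputableOn ((TTE.rhoTuple d N).prod (TTE.nu ℕ)) (TTE.psiUpper d)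
        (fun z => TTE.extchull d N z.1)
        {z | z.1 ∈ TTE.distinctTuples d N ∧ z.2 = (TTE.extPts z.1).ncard} ∧
      TTE.ComputableWithAdvice (TTE.rhoTuple d N) (TTE.psiUpper d) (TTE.extchull d N)
        (TTE.distinctTuples d N) (N - 1)) ∧
    -- (f) `N - 2` parts (or fewer) do not suffice, even for continuity, in dimension at least two
    (2 ≤ d → 2 ≤ N → ∀ k ≤ N - 2,
      ¬ TTE.KWiseContinuous (TTE.rhoTuple d N) (TTE.psiUpper d) (TTE.extchull d N)
        (TTE.distinctTuples d N) k) := by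
  refine ⟨fun x _ y hy => TTE.exists_halfspace_of_mem_extPts hd hy,
    fun x _ u t j _ h => TTE.mem_extPts_of_halfspace h,
    TTE.semiDecidableOn_mem_extPts hd, TTE.computableOn_extchull_psiLower hd,
    fun hN => ⟨fun x hx => ⟨TTE.two_le_ncard_extPts hN hx, TTE.ncard_extPts_le hx,
      TTE.card_extIndices hx, TTE.extPts_eq_image x⟩, TTE.computableOn_extIndices hd,
      TTE.computableOn_extchull_psiUpper hd, TTE.computableWithAdvice_extchull hd hN⟩,
    fun hd2 hN k hk => TTE.not_kWiseContinuous_extchull hd2 hN hk⟩
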